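/- Let $A$ be an artin algebra, i.e. an algebra that is finitely generated as a module over a commutative artinian ring $k$; modules are left modules, and $A\text{-mod}$ is the category of finitely generated ones. Call $A$ Gorenstein if the regular module $A$ has finite injective dimension both as a left and as a right $A$-module. A simple $A$-module $S$ is called localizable if ${\rm proj.dim}_A\, S\le 1$ and ${\rm Ext}^1_A(S,S)=0$. For such $S$ put $$S^\perp=\{X\in A\text{-mod}\mid {\rm Hom}_A(S,X)=0={\rm Ext}^1_A(S,X)\}.$$ There is a universal morphism of $A$-modules $\eta_A\colon A\to L(A)$ from $A$ to $S^\perp$: $L(A)$ lies in $S^\perp$, and every morphism from $A$ to an object of $S^\perp$ factors uniquely through $\eta_A$. The module $L(A)$ is an artin algebra with the product $x\star y=\rho_y(x)$, where $\rho_y\colon L(A)\to L(A)$ is the unique $A$-linear map with $\rho_y(\eta_A(a))=a.y$ for all $a\in A$. Then $\eta_A\colon A\to L(A)$ is a homomorphism of algebras, called the left retraction associated to $S$. Let $S$ and $S'$ be two non-isomorphic localizable $A$-modules, and let $\eta_A\colon A\to L(A)$ and $\eta'_A\colon A\to L'(A)$ be the corresponding left retractions. Then $A$ is Gorenstein if and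 only if both $L(A)$ and $L'(A)$ are Gorenstein. -/

import Mathlib

open CategoryTheory CategoryTheory.Abelian

universe u v

namespace Retraction

section Basic

variable (A : Type u) [Ring A]

/-- A ring is Gorenstein if the regular module has finite injective dimension on both sides.
This is the definition used for artin algebras. -/
def IsGorenstein : Prop :=
  (∃ d : ℕ, HasInjectiveDimensionLE (ModuleCat.of A A) d) ∧
    (∃ d : ℕ, HasInjectiveDimensionLE (ModuleCat.of Aᵐᵒᵖ A) d)

variable (S : Type u) [AddCommGroup S] [Module A S]

/-- A localizable module: a simple module of projective dimension at most one
without self-extensions. -/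
structure IsLocalizable : Prop where
  simple : IsSimpleModule A S
  projDim : HasProjectiveDimensionLE (ModuleCat.of A S) 1
  ext : Subsingleton (Ext.{u} (ModuleCat.of A S) (ModuleCat.of A S) 1)

/-- Membership in the perpendicular subcategory `S^⊥` of the category of
finitely generated modules. -/
structure IsPerp (X : Type u) [AddCommGroup X] [Module A X] : Prop where
  finite : Module.Finite A X
  hom : ∀ f : S →ₗ[A] X, f = 0
  ext : Subsingleton (Ext.{u} (ModuleCat.of A S) (ModuleCat.of A X) 1)

/-- A universal morphism `η` from a module `X` to the perpendicular subcategory `S^⊥`, i.e. the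
value `η_X : X → L(X)` at `X` of the unit of the adjunction between the inclusion of `S^⊥` and
its left adjoint. -/
structure UniversalMorphism (X : Type u) [AddCommGroup X] [Module A X] where
  obj : Type u
  [addCommGroup : AddCommGroup obj]
  [module : Module A obj]
  isPerp : IsPerp A S obj
  η : X →ₗ[A] obj
  universal : ∀ (Z : Type u) [AddCommGroup Z] [Module A Z], IsPerp A S Z →
    ∀ f : X →ₗ[A] Z, ∃! g : obj →ₗ[A] Z, g ∘ₗ η = f

attribute [instance] UniversalMorphism.addCommGroup UniversalMorphism.module

end Basic

/-! ### Existence of the universal morphism `A → L(A)` -/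

section Existence

variable {A : Type u} [Ring A]
variable {S : Type u} [AddCommGroup S] [Module A S]

lemma projective_ker (hS : IsLocalizable A S) {π : A →ₗ[A] S} (hπ : Function.Surjective π) :
    Module.Projective A (LinearMap.ker π) := by
  have hx := LinearMap.shortExact_shortComplexKer hπ
  have := hS.projDim
  have h2 : Projective π.shortComplexKer.X₂ :=
    inferInstanceAs (Projective (ModuleCat.of A A))
  have h1 := (hx.hasProjectiveDimensionLT_X₃_iff 0 h2).1 this
  have h3 := projective_iff_hasProjectiveDimensionLT_one.2 h1
  exact (IsProjective.iff_projective (LinearMap.ker π)).2 h3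

lemma subsingleton_ext_iff {π : A →ₗ[A] S} (hπ : Function.Surjective π)
    (X : Type u) [AddCommGroup X] [Module A X] :
    Subsingleton (Ext.{u} (ModuleCat.of A S) (ModuleCat.of A X) 1) ↔
      ∀ f : LinearMap.ker π →ₗ[A] X, ∃ x : X, ∀ i : LinearMap.ker π, f i = (i : A) • x := by
  have hx := LinearMap.shortExact_shortComplexKer hπ
  have h2 : Projective π.shortComplexKer.X₂ :=
    inferInstanceAs (Projective (ModuleCat.of A A))
  constructor
  · intro h f
    obtain ⟨g, hg⟩ := Ext.contravariant_sequence_exact₁ hx (ModuleCat.of A X)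
      (Ext.mk₀ (ModuleCat.ofHom f)) (add_zero 1) (Subsingleton.elim (α := Ext.{u} (ModuleCat.of A S) (ModuleCat.of A X) 1) _ _)
    obtain ⟨g, rfl⟩ := (Ext.mk₀_bijective _ _).2 g
    rw [Ext.mk₀_comp_mk₀] at hg
    have hg := (Ext.mk₀_bijective _ _).1 hg
    refine ⟨g.hom (1 : A), fun i ↦ ?_⟩
    have h3 := congrArg (fun t ↦ t.hom i) hg
    have h4 : g.hom (i : A) = f i := h3
    rw [← h4, ← map_smul, smul_eq_mul, mul_one]
  · intro h
    refine subsingleton_of_forall_eq 0 fun e ↦ ?_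
    obtain ⟨f, rfl⟩ := precomp_extClass_surjective_of_projective_X₂ (ModuleCat.of A X) hx 0 e
    obtain ⟨f, rfl⟩ := (Ext.mk₀_bijective _ _).2 f
    obtain ⟨x, hx'⟩ := h f.hom
    have : f = π.shortComplexKer.f ≫ ModuleCat.ofHom (LinearMap.toSpanSingleton A X x) := by
      ext i
      exact hx' i
    rw [this, ← Ext.mk₀_comp_mk₀]
    exact hx.extClass_comp_assoc _ (h := add_zero 1)

lemma toSpanSingleton_eq_lift {π : A →ₗ[A] S} (hπ : Function.Surjective π)
    {X : Type*} [AddCommGroup X] [Module A X] (x : X)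
    (hx : ∀ i : LinearMap.ker π, (i : A) • x = 0) :
    ∃ f : S →ₗ[A] X, f (π 1) = x := by
  let e := π.quotKerEquivOfSurjective hπ
  refine ⟨((LinearMap.ker π).liftQ (LinearMap.toSpanSingleton A X x)
    (fun i hi ↦ by simpa using hx ⟨i, hi⟩)) ∘ₗ e.symm.toLinearMap, ?_⟩
  have : e.symm (π 1) = (LinearMap.ker π).mkQ 1 := by
    rw [LinearEquiv.symm_apply_eq]; rfl
  simp [this]

theorem nonempty_universalMorphism (k : Type v) [CommRing k] [IsArtinianRing k]
    [Algebra k A] [Module.Finite k A] (hS : IsLocalizable A S) :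
    Nonempty (UniversalMorphism A S A) := by
  have := hS.simple
  have : IsNoetherianRing A := isNoetherian_of_tower k inferInstance
  have : Nontrivial S := IsSimpleModule.nontrivial A S
  obtain ⟨s, hs⟩ := exists_ne (0 : S)
  let π : A →ₗ[A] S := LinearMap.toSpanSingleton A S s
  have hπ : Function.Surjective π := IsSimpleModule.toSpanSingleton_surjective A hs
  let I := LinearMap.ker π
  have hproj : Module.Projective A I := projective_ker hS hπ
  have hES := (subsingleton_ext_iff hπ S).1 hS.ext
  -- finitely many generators of `Hom(I, A)`
  have hfin : Module.Finite k (I →ₗ[A] A) := by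
    have h1 : Module.Finite k I :=
      Module.Finite.of_injective (I.subtype.restrictScalars k) I.injective_subtype
    exact Module.Finite.of_injective (LinearMap.restrictScalarsₗ k A I A k)
      (LinearMap.restrictScalars_injective k)
  obtain ⟨m, f, hf⟩ := Module.Finite.exists_fin (R := k) (M := I →ₗ[A] A)
  -- the universal extension `X'`
  let φ : (Fin m → I) →ₗ[A] A × (Fin m → A) := LinearMap.prod
    (∑ j, f j ∘ₗ LinearMap.proj j) (-(LinearMap.pi fun j ↦ I.subtype ∘ₗ LinearMap.proj j))
  let X' := (A × (Fin m → A)) ⧸ LinearMap.range φ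
  let q : A × (Fin m → A) →ₗ[A] X' := (LinearMap.range φ).mkQ
  have hq : Function.Surjective q := Submodule.mkQ_surjective _
  have hφ : ∀ v : Fin m → I, q (∑ j, f j (v j), 0) = q (0, fun j ↦ (v j : A)) := by
    intro v
    rw [← sub_eq_zero, ← map_sub, ← LinearMap.mem_ker, Submodule.ker_mkQ]
    refine ⟨v, ?_⟩
    ext <;> simp [φ, LinearMap.prod_apply]
  have hEX' : ∀ g : I →ₗ[A] X', ∃ x : X', ∀ i : I, g i = (i : A) • x := by
    intro g
    obtain ⟨g', hg'⟩ := Module.projective_lifting_property q g hq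
    have h2 : ∀ j : Fin m, ∃ a : A, ∀ i : I, (g' i).2 j - (i : A) * a ∈ I := by
      intro j
      obtain ⟨t, ht⟩ := hES (π ∘ₗ LinearMap.proj j ∘ₗ LinearMap.snd A A (Fin m → A) ∘ₗ g')
      obtain ⟨a, rfl⟩ := hπ t
      refine ⟨a, fun i ↦ ?_⟩
      have h3 := ht i
      simp only [LinearMap.comp_apply, LinearMap.proj_apply, LinearMap.snd_apply] at h3
      rw [LinearMap.mem_ker, map_sub, h3, sub_eq_zero, ← smul_eq_mul, map_smul]
    choose a ha using h2
    let w : I →ₗ[A] (Fin m → I) := LinearMap.pi fun j ↦ LinearMap.codRestrict I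
      (LinearMap.proj j ∘ₗ LinearMap.snd A A (Fin m → A) ∘ₗ g' -
        LinearMap.toSpanSingleton A A (a j) ∘ₗ I.subtype) (fun i ↦ by simpa using ha j i)
    let h : I →ₗ[A] A := LinearMap.fst A A (Fin m → A) ∘ₗ g' + ∑ j, f j ∘ₗ LinearMap.proj j ∘ₗ w
    have hh : h ∈ Submodule.span k (Set.range f) := by rw [hf]; trivial
    obtain ⟨c, hc⟩ := (Submodule.mem_span_range_iff_exists_fun k).1 hh
    refine ⟨q (0, a) + q (0, fun j ↦ c j • (1 : A)), fun i ↦ ?_⟩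
    have e1 : g i = q (g' i) := by rw [← hg']; rfl
    have e2 : g' i = (i : A) • ((0, a) : A × (Fin m → A)) + (((g' i).1, 0) + (0, fun j ↦ (w i j : A))) := by
      ext <;> simp [w]
    have e3 : q ((g' i).1, 0) + q (0, fun j ↦ (w i j : A)) = q (h i, 0) := by
      rw [← hφ, ← map_add]
      congr 1
      ext <;> simp [h]
    have e4 : (h i, (0 : Fin m → A)) = (∑ j, f j (c j • i), 0) := by
      rw [← hc]
      congr 1
      simp only [LinearMap.sum_apply, LinearMap.smul_apply]
      refine Finset.sum_congr rfl fun j _ ↦ ?_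
      have : c j • i = (algebraMap k A (c j)) • i := (algebraMap_smul A (c j) i).symm
      rw [this, map_smul, algebraMap_smul]
    rw [e1, e2, map_add, map_add, map_smul, e3, e4, hφ (fun j ↦ c j • i), smul_add]
    congr 1
    rw [← map_smul]
    congr 1
    ext <;> simp
  -- the quotient by the trace of `S`
  let T : Submodule A X' := isotypicComponent A X' S
  have hST : ∀ (g : S →ₗ[A] X') (s : S), g s ∈ T := by
    intro g s
    have h1 := LinearMap.le_comap_isotypicComponent S g
    have h2 : (⊤ : Submodule A S) ≤ isotypicComponent A S S :=
      le_sSup ⟨Submodule.topEquiv⟩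
    exact h1 (h2 trivial)
  have hET : ∀ g : I →ₗ[A] T, ∃ x : T, ∀ i : I, g i = (i : A) • x := by
    intro g
    obtain ⟨n, ⟨e⟩⟩ := (IsIsotypicOfType.isotypicComponent A X' (S := S)).linearEquiv_fun
    choose x hx using fun j ↦ hES (LinearMap.proj j ∘ₗ e.toLinearMap ∘ₗ g)
    refine ⟨e.symm x, fun i ↦ ?_⟩
    rw [← map_smul, LinearEquiv.eq_symm_apply]
    ext j
    exact hx j i
  let p : X' →ₗ[A] X' ⧸ T := T.mkQ
  have hp : Function.Surjective p := Submodule.mkQ_surjective _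
  have hperp : IsPerp A S (X' ⧸ T) := by
    refine ⟨inferInstance, fun g ↦ ?_, (subsingleton_ext_iff hπ _).2 fun g ↦ ?_⟩
    · obtain ⟨y, hy⟩ := hp (g (π 1))
      have hyT : ∀ i : I, (i : A) • y ∈ T := by
        intro i
        have : p ((i : A) • y) = 0 := by
          have hi : π (i : A) = 0 := i.2
          rw [map_smul, hy, ← map_smul, ← map_smul, smul_eq_mul, mul_one, hi, map_zero]
        rwa [← LinearMap.mem_ker, Submodule.ker_mkQ] at this
      obtain ⟨t, ht⟩ := hET
        (LinearMap.codRestrict T (LinearMap.toSpanSingleton A X' y ∘ₗ I.subtype) hyT)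
      obtain ⟨g', hg'⟩ := toSpanSingleton_eq_lift hπ (y - t) (fun i ↦ by
        have := congrArg Subtype.val (ht i)
        rw [smul_sub, sub_eq_zero]
        exact this)
      have hyT' : y ∈ T := by
        have h5 := hST g' (π 1)
        rw [hg'] at h5
        simpa using T.add_mem h5 t.2
      have h6 : g (π 1) = 0 := by rw [← hy]; simpa [p] using hyT'
      ext x
      obtain ⟨b, rfl⟩ := hπ x
      have : π b = b • π 1 := by rw [← map_smul, smul_eq_mul, mul_one]
      rw [this, map_smul, h6]
      simp
    · obtain ⟨g', hg'⟩ := Module.projective_lifting_property p g hp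
      obtain ⟨x, hx⟩ := hEX' g'
      refine ⟨p x, fun i ↦ ?_⟩
      rw [← hg', LinearMap.comp_apply, hx, map_smul]
  refine ⟨⟨X' ⧸ T, hperp, p ∘ₗ q ∘ₗ LinearMap.inl A A (Fin m → A), fun Z _ _ hZ F ↦ ?_⟩⟩
  have hEZ := (subsingleton_ext_iff hπ Z).1 hZ.ext
  choose z hz using fun j ↦ hEZ (F ∘ₗ f j)
  let G : A × (Fin m → A) →ₗ[A] Z := LinearMap.coprod F
    (∑ j, LinearMap.toSpanSingleton A Z (z j) ∘ₗ LinearMap.proj j)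
  have hG : LinearMap.range φ ≤ LinearMap.ker G := by
    rintro _ ⟨v, rfl⟩
    have : ∀ j, F (f j (v j)) = (v j : A) • z j := fun j ↦ hz j (v j)
    simp [G, φ, LinearMap.prod_apply, this]
  let G' : X' →ₗ[A] Z := (LinearMap.range φ).liftQ G hG
  have hT : T ≤ LinearMap.ker G' := by
    refine sSup_le fun N ⟨e⟩ x hx ↦ ?_
    have h1 := hZ.hom (G' ∘ₗ N.subtype ∘ₗ e.symm.toLinearMap)
    have h2 := LinearMap.congr_fun h1 (e ⟨x, hx⟩)
    simpa using h2
  have hlift : T.liftQ G' hT ∘ₗ p ∘ₗ q ∘ₗ LinearMap.inl A A (Fin m → A) = F := by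
    refine LinearMap.ext fun b ↦ ?_
    have : G (b, 0) = F b := by simp [G]
    exact this
  refine ⟨T.liftQ G' hT, hlift, fun g hg ↦ ?_⟩
  · have key : ∀ d : (X' ⧸ T) →ₗ[A] Z,
        d ∘ₗ p ∘ₗ q ∘ₗ LinearMap.inl A A (Fin m → A) = 0 → d = 0 := by
      intro d hd
      have h0 : ∀ b : A, d (p (q (b, 0))) = 0 := fun b ↦ LinearMap.congr_fun hd b
      have h1 : ∀ j, d (p (q (0, Pi.single j 1))) = 0 := by
        intro j
        obtain ⟨g', hg'⟩ := toSpanSingleton_eq_lift hπ (d (p (q (0, Pi.single j 1))))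
          (fun i ↦ by
            have h2 := hφ (Pi.single j i)
            rw [← map_smul, ← map_smul, ← map_smul]
            have h3 : (i : A) • ((0, Pi.single j 1) : A × (Fin m → A)) =
                (0, fun l ↦ ((Pi.single j i : Fin m → I) l : A)) := by
              ext l
              · simp
              · by_cases hl : l = j
                · subst hl; simp
                · simp [Pi.single_eq_of_ne hl]
            rw [h3, ← h2, h0])
        rw [← hg', hZ.hom g']
        rfl
      have h2 : d ∘ₗ p ∘ₗ q = 0 := by
        apply LinearMap.prod_ext
        · ext; simpa using h0 1
        · refine LinearMap.pi_ext' fun j ↦ ?_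
          ext
          simpa using h1 j
      refine LinearMap.ext fun x ↦ ?_
      obtain ⟨x, rfl⟩ := hp x
      obtain ⟨x, rfl⟩ := hq x
      exact LinearMap.congr_fun h2 x
    have := key (g - T.liftQ G' hT) (by
      rw [LinearMap.sub_comp, hlift, sub_eq_zero]
      exact hg)
    exact sub_eq_zero.1 this

end Existence

/-! ### The algebra `L(A)` -/

section Algebra

variable (k : Type v) [CommRing k] [IsArtinianRing k]
variable (A : Type u) [Ring A] [Algebra k A] [Module.Finite k A]
variable (S : Type u) [AddCommGroup S] [Module A S] (hS : IsLocalizable A S)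

/-- The universal morphism `η_A : A → L(A)` from the regular module to `S^⊥`. -/
noncomputable def regularUniversal : UniversalMorphism A S A :=
  (nonempty_universalMorphism k hS).some

/-- The underlying type of `L(A)`, where `(L, η)` is the localization functor associated to the
localizable module `S`. -/
def LeftRetraction : Type u := (regularUniversal k A S hS).obj

namespace LeftRetraction

noncomputable instance : AddCommGroup (LeftRetraction k A S hS) :=
  inferInstanceAs (AddCommGroup (regularUniversal k A S hS).obj)

noncomputable instance : Module A (LeftRetraction k A S hS) :=
  inferInstanceAs (Module A (regularUniversal k A S hS).obj)

/-- The morphism `η_A : A → L(A)` as a morphism of modules. -/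
noncomputable def η : A →ₗ[A] LeftRetraction k A S hS := (regularUniversal k A S hS).η

lemma isPerp : IsPerp A S (LeftRetraction k A S hS) := (regularUniversal k A S hS).isPerp

lemma universal (Z : Type u) [AddCommGroup Z] [Module A Z] (hZ : IsPerp A S Z) (f : A →ₗ[A] Z) :
    ∃! g : LeftRetraction k A S hS →ₗ[A] Z, g ∘ₗ η k A S hS = f :=
  (regularUniversal k A S hS).universal Z hZ f

variable {k A S hS}

/-- The unique endomorphism of the module `L(A)` extending `r_y : A → L(A)`, `a ↦ a • y`, along
`η_A`; it equals `L(η_A)⁻¹ ∘ L(r_y)`. -/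
noncomputable def extend (y : LeftRetraction k A S hS) :
    LeftRetraction k A S hS →ₗ[A] LeftRetraction k A S hS :=
  (universal k A S hS _ (isPerp k A S hS)
    (LinearMap.toSpanSingleton A (LeftRetraction k A S hS) y)).choose

lemma extend_η (y : LeftRetraction k A S hS) (a : A) : extend y (η k A S hS a) = a • y :=
  LinearMap.congr_fun (universal k A S hS _ (isPerp k A S hS)
    (LinearMap.toSpanSingleton A (LeftRetraction k A S hS) y)).choose_spec.1 a

lemma hom_ext {f g : LeftRetraction k A S hS →ₗ[A] LeftRetraction k A S hS}
    (h : f (η k A S hS 1) = g (η k A S hS 1)) : f = g :=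
  (universal k A S hS _ (isPerp k A S hS) (g ∘ₗ η k A S hS)).unique
    (LinearMap.ext_ring h) rfl

lemma extend_one : extend (η k A S hS 1) = LinearMap.id :=
  hom_ext (by simp [extend_η])

lemma extend_add (y z : LeftRetraction k A S hS) : extend (y + z) = extend y + extend z :=
  hom_ext (by simp [extend_η])

lemma extend_zero : extend (0 : LeftRetraction k A S hS) = 0 :=
  hom_ext (by simp [extend_η])

lemma extend_extend (y z : LeftRetraction k A S hS) :
    extend (extend z y) = extend z ∘ₗ extend y :=
  hom_ext (by simp [extend_η])

/-- The ring structure on `L(A)`, with product `x ⋆ y = L(η_A)⁻¹ (L(r_y) x)`. -/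
noncomputable instance : Ring (LeftRetraction k A S hS) where
  __ := (inferInstance : AddCommGroup (LeftRetraction k A S hS))
  mul x y := extend y x
  one := η k A S hS 1
  left_distrib x y z := LinearMap.congr_fun (extend_add y z) x
  right_distrib x y z := map_add (extend z) x y
  zero_mul x := map_zero (extend x)
  mul_zero x := LinearMap.congr_fun extend_zero x
  mul_assoc x y z := (LinearMap.congr_fun (extend_extend y z) x).symm
  one_mul x := (extend_η x 1).trans (one_smul A x)
  mul_one x := LinearMap.congr_fun extend_one x

lemma mul_def (x y : LeftRetraction k A S hS) : x * y = extend y x := rfl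

variable (k A S hS) in
/-- The left retraction `η_A : A → L(A)` associated to `S`, a homomorphism of rings. -/
noncomputable def ηRingHom : A →+* LeftRetraction k A S hS where
  toFun := η k A S hS
  map_one' := rfl
  map_zero' := map_zero _
  map_add' := map_add _
  map_mul' a b := by rw [mul_def, extend_η, ← map_smul, smul_eq_mul]

/-- `L(A)` is an algebra over the base ring via `η_A`. -/
noncomputable instance : Algebra k (LeftRetraction k A S hS) :=
  ((ηRingHom k A S hS).comp (algebraMap k A)).toAlgebra' fun c x ↦ by
    let m : LeftRetraction k A S hS →ₗ[A] LeftRetraction k A S hS :=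
      { toFun := fun y ↦ algebraMap k A c • y
        map_add' := smul_add _
        map_smul' := fun a y ↦ by
          rw [RingHom.id_apply, smul_smul, smul_smul, Algebra.commutes] }
    have h : extend (η k A S hS (algebraMap k A c)) = m := hom_ext (by
      change _ = algebraMap k A c • η k A S hS 1
      rw [extend_η, one_smul, ← map_smul, smul_eq_mul, mul_one])
    exact (extend_η x _).trans (LinearMap.congr_fun h x).symm

lemma algebraMap_smul_eq (c : k) (x : LeftRetraction k A S hS) : c • x = algebraMap k A c • x :=
  extend_η x _

/-- `L(A)` is an artin algebra over the base ring. -/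
instance : Module.Finite k (LeftRetraction k A S hS) := by
  have : Module.Finite A (LeftRetraction k A S hS) := (isPerp k A S hS).finite
  have : IsScalarTower k A (LeftRetraction k A S hS) :=
    .of_algebraMap_smul fun c x ↦ (algebraMap_smul_eq c x).symm
  exact Module.Finite.trans A _

end LeftRetraction

end Algebra

end Retraction

/-! Both halves of the Gorenstein condition can be read on left modules. If `E` is dualizing over
the base and D = Hom(-, E), the injective dimension of the right regular module is the projective
dimension of the left module D(A), a finitely generated injective cogenerator
(`exists_injective_cogenerator`). So A is Gorenstein iff A has finite injective dimension and D(A)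
has finite projective dimension. The first condition makes finitely generated modules of finite
projective dimension have finite injective dimension, and the second gives the converse
(`FinProjDim.finInjDim`, `FinInjDim.finProjDim`).

Put B = L(A). The finitely generated B-modules are the objects of S^⊥, with the same morphisms.
Every finitely generated A-module maps to an object of S^⊥ with kernel and cokernel powers of S
(`exists_perp_approximation`). Injective B-modules stay injective over A, and B has finite
projective dimension over A. Hence finiteness of either dimension of a finitely generated B-module
can be tested over A (`finInjDim_iff`, `finProjDim_iff`).

If A is Gorenstein, S has finite injective dimension because its projective dimension is at most
one. So A → B passes finite injective dimension on to B. The injective cogenerator of B is injective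
over A, hence of finite projective dimension.

Conversely, once S has finite injective dimension over A, the maps A → B and D(A) → Y to S^⊥ bring
both conditions back from B. But L kills S, so B alone says nothing about S; this is why two
localizable modules are needed. One of Ext¹(S, S'), Ext¹(S', S) vanishes
(`IsLocalizable.ext_or_ext`), say the first. Then S' is a B-module, and it has finite injective
dimension since B is Gorenstein. Approximating S in S'^⊥ and using that L'(A) is Gorenstein, S has
finite injective dimension too. -/

namespace Retraction

/-! ### Finite homological dimensions -/

section Dimensions

variable (R : Type u) [Ring R]

/-- The module `M` has finite injective dimension. -/
def FinInjDim (M : Type u) [AddCommGroup M] [Module R M] : Prop :=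
  ∃ d : ℕ, HasInjectiveDimensionLE (ModuleCat.of R M) d

/-- The module `M` has finite projective dimension. -/
def FinProjDim (M : Type u) [AddCommGroup M] [Module R M] : Prop :=
  ∃ d : ℕ, HasProjectiveDimensionLE (ModuleCat.of R M) d

variable {R}
variable {M N P : Type u} [AddCommGroup M] [Module R M] [AddCommGroup N] [Module R N]
  [AddCommGroup P] [Module R P]

/-- The short exact sequence of modules with given injection and surjection. -/
lemma shortExact_of_exact {f : M →ₗ[R] N} {g : N →ₗ[R] P} (hf : Function.Injective f)
    (hfg : Function.Exact f g) (hg : Function.Surjective g) :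
    (ModuleCat.shortComplexOfCompEqZero f g hfg.linearMap_comp_eq_zero).ShortExact :=
  ModuleCat.shortComplex_shortExact _ hfg hf hg

lemma finInjDim_of_injective [Module.Injective R M] : FinInjDim R M :=
  ⟨0, injective_iff_hasInjectiveDimensionLT_one.1
    ((Module.injective_iff_injective_object R M).1 inferInstance)⟩

lemma finProjDim_of_projective [Module.Projective R M] : FinProjDim R M :=
  ⟨0, projective_iff_hasProjectiveDimensionLT_one.1
    ((IsProjective.iff_projective M).1 inferInstance)⟩

lemma injective_iff_hasInjectiveDimensionLE_zero :
    Module.Injective R M ↔ HasInjectiveDimensionLE (ModuleCat.of R M) 0 :=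
  (Module.injective_iff_injective_object R M).trans injective_iff_hasInjectiveDimensionLT_one

lemma projective_iff_hasProjectiveDimensionLE_zero :
    Module.Projective R M ↔ HasProjectiveDimensionLE (ModuleCat.of R M) 0 :=
  (IsProjective.iff_projective M).trans projective_iff_hasProjectiveDimensionLT_one

lemma hasInjectiveDimensionLE_succ_iff {f : M →ₗ[R] N} {g : N →ₗ[R] P}
    (hf : Function.Injective f) (hfg : Function.Exact f g) (hg : Function.Surjective g)
    [Module.Injective R N] (d : ℕ) :
    HasInjectiveDimensionLE (ModuleCat.of R M) (d + 1) ↔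
      HasInjectiveDimensionLE (ModuleCat.of R P) d :=
  ((shortExact_of_exact hf hfg hg).hasInjectiveDimensionLT_X₃_iff d
    ((Module.injective_iff_injective_object R N).1 inferInstance)).symm

lemma hasProjectiveDimensionLE_succ_iff {f : M →ₗ[R] N} {g : N →ₗ[R] P}
    (hf : Function.Injective f) (hfg : Function.Exact f g) (hg : Function.Surjective g)
    [Module.Projective R N] (d : ℕ) :
    HasProjectiveDimensionLE (ModuleCat.of R P) (d + 1) ↔
      HasProjectiveDimensionLE (ModuleCat.of R M) d :=
  (shortExact_of_exact hf hfg hg).hasProjectiveDimensionLT_X₃_iff d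
    ((IsProjective.iff_projective N).1 inferInstance)

namespace FinInjDim

/-- In this form the degree `a + b` serves two modules at once, with room for the shift by one along
a short exact sequence. -/
lemma exists_lt (h : FinInjDim R M) :
    ∃ d : ℕ, ∀ e ≥ d, HasInjectiveDimensionLT (ModuleCat.of R M) e := by
  obtain ⟨d, hd⟩ := h
  exact ⟨d + 1, fun e he ↦ hasInjectiveDimensionLT_of_ge _ (d + 1) e he⟩

lemma of_retract (i : M →ₗ[R] N) (r : N →ₗ[R] M) (h : r ∘ₗ i = LinearMap.id)
    (hN : FinInjDim R N) : FinInjDim R M := by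
  obtain ⟨d, hd⟩ := hN
  let ρ : Retract (ModuleCat.of R M) (ModuleCat.of R N) :=
    ⟨ModuleCat.ofHom i, ModuleCat.ofHom r, by rw [← ModuleCat.ofHom_comp, h]; rfl⟩
  exact ⟨d, ρ.hasInjectiveDimensionLT _⟩

lemma of_equiv (e : M ≃ₗ[R] N) (hN : FinInjDim R N) : FinInjDim R M :=
  of_retract e.toLinearMap e.symm.toLinearMap (by ext; simp) hN

section Exact

variable {f : M →ₗ[R] N} {g : N →ₗ[R] P} (hf : Function.Injective f)
  (hfg : Function.Exact f g) (hg : Function.Surjective g)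
include hf hfg hg

lemma middle (h₁ : FinInjDim R M) (h₃ : FinInjDim R P) : FinInjDim R N := by
  obtain ⟨a, ha⟩ := h₁.exists_lt
  obtain ⟨b, hb⟩ := h₃.exists_lt
  exact ⟨a + b, (shortExact_of_exact hf hfg hg).hasInjectiveDimensionLT_X₂ _
    (ha _ (by omega)) (hb _ (by omega))⟩

lemma left (h₂ : FinInjDim R N) (h₃ : FinInjDim R P) : FinInjDim R M := by
  obtain ⟨a, ha⟩ := h₂.exists_lt
  obtain ⟨b, hb⟩ := h₃.exists_lt
  exact ⟨a + b, (shortExact_of_exact hf hfg hg).hasInjectiveDimensionLT_X₁ _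
    (hb _ (by omega)) (ha _ (by omega))⟩

lemma right (h₁ : FinInjDim R M) (h₂ : FinInjDim R N) : FinInjDim R P := by
  obtain ⟨a, ha⟩ := h₁.exists_lt
  obtain ⟨b, hb⟩ := h₂.exists_lt
  exact ⟨a + b, (shortExact_of_exact hf hfg hg).hasInjectiveDimensionLT_X₃ _
    (hb _ (by omega)) (ha _ (by omega))⟩

end Exact

end FinInjDim

namespace FinProjDim

lemma exists_lt (h : FinProjDim R M) :
    ∃ d : ℕ, ∀ e ≥ d, HasProjectiveDimensionLT (ModuleCat.of R M) e := by
  obtain ⟨d, hd⟩ := h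
  exact ⟨d + 1, fun e he ↦ hasProjectiveDimensionLT_of_ge _ (d + 1) e he⟩

lemma of_retract (i : M →ₗ[R] N) (r : N →ₗ[R] M) (h : r ∘ₗ i = LinearMap.id)
    (hN : FinProjDim R N) : FinProjDim R M := by
  obtain ⟨d, hd⟩ := hN
  let ρ : Retract (ModuleCat.of R M) (ModuleCat.of R N) :=
    ⟨ModuleCat.ofHom i, ModuleCat.ofHom r, by rw [← ModuleCat.ofHom_comp, h]; rfl⟩
  exact ⟨d, ρ.hasProjectiveDimensionLT _⟩

lemma of_equiv (e : M ≃ₗ[R] N) (hN : FinProjDim R N) : FinProjDim R M :=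
  of_retract e.toLinearMap e.symm.toLinearMap (by ext; simp) hN

section Exact

variable {f : M →ₗ[R] N} {g : N →ₗ[R] P} (hf : Function.Injective f)
  (hfg : Function.Exact f g) (hg : Function.Surjective g)
include hf hfg hg

lemma middle (h₁ : FinProjDim R M) (h₃ : FinProjDim R P) : FinProjDim R N := by
  obtain ⟨a, ha⟩ := h₁.exists_lt
  obtain ⟨b, hb⟩ := h₃.exists_lt
  exact ⟨a + b, (shortExact_of_exact hf hfg hg).hasProjectiveDimensionLT_X₂ _
    (ha _ (by omega)) (hb _ (by omega))⟩

lemma left (h₂ : FinProjDim R N) (h₃ : FinProjDim R P) : FinProjDim R M := by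
  obtain ⟨a, ha⟩ := h₂.exists_lt
  obtain ⟨b, hb⟩ := h₃.exists_lt
  exact ⟨a + b, (shortExact_of_exact hf hfg hg).hasProjectiveDimensionLT_X₁ _
    (ha _ (by omega)) (hb _ (by omega))⟩

lemma right (h₁ : FinProjDim R M) (h₂ : FinProjDim R N) : FinProjDim R P := by
  obtain ⟨a, ha⟩ := h₁.exists_lt
  obtain ⟨b, hb⟩ := h₂.exists_lt
  exact ⟨a + b, (shortExact_of_exact hf hfg hg).hasProjectiveDimensionLT_X₃ _
    (ha _ (by omega)) (hb _ (by omega))⟩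

end Exact

end FinProjDim

section Pi

variable (M) in
lemma exact_single_funLeft (n : ℕ) :
    Function.Injective (LinearMap.single R (fun _ : Fin (n + 1) ↦ M) 0) ∧
    Function.Exact (LinearMap.single R (fun _ : Fin (n + 1) ↦ M) 0)
      (LinearMap.funLeft R M (Fin.succ (n := n))) ∧
    Function.Surjective (LinearMap.funLeft R M (Fin.succ (n := n))) := by
  refine ⟨Pi.single_injective (M := fun _ : Fin (n + 1) ↦ M) 0, fun x ↦ ⟨fun h ↦ ⟨x 0, ?_⟩, ?_⟩, fun y ↦
    ⟨Fin.cons 0 y, by ext; simp [LinearMap.funLeft]⟩⟩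
  · ext i
    refine Fin.cases (by simp) (fun j ↦ ?_) i
    simpa [LinearMap.funLeft] using (congrFun h j).symm
  · rintro ⟨y, rfl⟩
    ext j
    simp [LinearMap.funLeft]

lemma FinInjDim.pi (h : FinInjDim R M) (n : ℕ) : FinInjDim R (Fin n → M) := by
  induction n with
  | zero =>
    have : Module.Injective R (Fin 0 → M) := ⟨fun _ _ _ _ _ _ _ _ _ ↦
      ⟨0, fun _ ↦ Subsingleton.elim _ _⟩⟩
    exact finInjDim_of_injective
  | succ n ih =>
    obtain ⟨h₁, h₂, h₃⟩ := exact_single_funLeft (R := R) M n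
    exact FinInjDim.middle h₁ h₂ h₃ h ih

lemma FinProjDim.pi (h : FinProjDim R M) (n : ℕ) : FinProjDim R (Fin n → M) := by
  induction n with
  | zero => exact finProjDim_of_projective
  | succ n ih =>
    obtain ⟨h₁, h₂, h₃⟩ := exact_single_funLeft (R := R) M n
    exact FinProjDim.middle h₁ h₂ h₃ h ih

end Pi

/-! ### Finite dimensions along a morphism with controlled kernel and cokernel. -/

section FourTerm

variable (f : M →ₗ[R] N)

lemma exact_ker_rangeRestrict : Function.Exact (LinearMap.ker f).subtype f.rangeRestrict :=
  LinearMap.exact_iff.2 (by rw [LinearMap.ker_rangeRestrict, Submodule.range_subtype])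

lemma exact_range_mkQ :
    Function.Exact (LinearMap.range f).subtype (LinearMap.range f).mkQ :=
  LinearMap.exact_iff.2 (by rw [Submodule.ker_mkQ, Submodule.range_subtype])

variable {f}

/-- Splits the four-term sequence at the image of `f`. It is applied to approximations, whose kernel
and cokernel are powers of a localizable module. -/
lemma FinInjDim.codomain (h₁ : FinInjDim R (LinearMap.ker f))
    (h₂ : FinInjDim R (N ⧸ LinearMap.range f)) (h : FinInjDim R M) : FinInjDim R N :=
  middle (LinearMap.range f).injective_subtype (exact_range_mkQ f) (Submodule.mkQ_surjective _)
    (right (LinearMap.ker f).injective_subtype (exact_ker_rangeRestrict f)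
      f.surjective_rangeRestrict h₁ h) h₂

lemma FinInjDim.domain (h₁ : FinInjDim R (LinearMap.ker f))
    (h₂ : FinInjDim R (N ⧸ LinearMap.range f)) (h : FinInjDim R N) : FinInjDim R M :=
  middle (LinearMap.ker f).injective_subtype (exact_ker_rangeRestrict f)
    f.surjective_rangeRestrict h₁
    (left (LinearMap.range f).injective_subtype (exact_range_mkQ f)
      (Submodule.mkQ_surjective _) h h₂)

lemma FinProjDim.codomain (h₁ : FinProjDim R (LinearMap.ker f))
    (h₂ : FinProjDim R (N ⧸ LinearMap.range f)) (h : FinProjDim R M) : FinProjDim R N :=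
  middle (LinearMap.range f).injective_subtype (exact_range_mkQ f) (Submodule.mkQ_surjective _)
    (right (LinearMap.ker f).injective_subtype (exact_ker_rangeRestrict f)
      f.surjective_rangeRestrict h₁ h) h₂

lemma FinProjDim.domain (h₁ : FinProjDim R (LinearMap.ker f))
    (h₂ : FinProjDim R (N ⧸ LinearMap.range f)) (h : FinProjDim R N) : FinProjDim R M :=
  middle (LinearMap.ker f).injective_subtype (exact_ker_rangeRestrict f)
    f.surjective_rangeRestrict h₁
    (left (LinearMap.range f).injective_subtype (exact_range_mkQ f)
      (Submodule.mkQ_surjective _) h h₂)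

end FourTerm

/-! ### Comparison and detection of dimensions by finitely generated modules. -/

section Noetherian

variable [IsNoetherianRing R]

/-- If the regular module has finite injective dimension, then so do all finitely generated
modules of finite projective dimension. -/
theorem FinProjDim.finInjDim (hR : FinInjDim R R) [Module.Finite R M] (hM : FinProjDim R M) :
    FinInjDim R M := by
  obtain ⟨d, hd⟩ := hM
  induction d generalizing M with
  | zero =>
    have := projective_iff_hasProjectiveDimensionLE_zero.2 hd
    obtain ⟨n, p, i, -, -, h⟩ := Module.Finite.exists_comp_eq_id_of_projective R M
    exact .of_retract i p h (hR.pi n)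
  | succ d ih =>
    obtain ⟨n, p, hp⟩ := Module.Finite.exists_fin' R M
    have hK := (hasProjectiveDimensionLE_succ_iff (LinearMap.ker p).injective_subtype
      p.exact_subtype_ker_map hp d).1 hd
    exact .right (LinearMap.ker p).injective_subtype p.exact_subtype_ker_map hp (ih hK)
      (hR.pi n)

omit [IsNoetherianRing R] in
/-- If `Q` is a finitely generated injective module cogenerating the finitely generated modules
and `Q` has finite projective dimension, then so do all finitely generated modules of finite
injective dimension. -/
theorem FinInjDim.finProjDim {Q : Type u} [AddCommGroup Q] [Module R Q] [Module.Finite R Q]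
    [Module.Injective R Q]
    (hQ : ∀ (X : Type u) [AddCommGroup X] [Module R X] [Module.Finite R X],
      ∃ (n : ℕ) (f : X →ₗ[R] Fin n → Q), Function.Injective f)
    (hR : FinProjDim R Q) [Module.Finite R M] (hM : FinInjDim R M) :
    FinProjDim R M := by
  obtain ⟨d, hd⟩ := hM
  induction d generalizing M with
  | zero =>
    have := injective_iff_hasInjectiveDimensionLE_zero.2 hd
    obtain ⟨n, i, hi⟩ := hQ M
    obtain ⟨r, hr⟩ := Module.Injective.extension_property R M M _ i hi LinearMap.id
    exact .of_retract i r hr (hR.pi n)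
  | succ d ih =>
    obtain ⟨n, i, hi⟩ := hQ M
    have hC := (hasInjectiveDimensionLE_succ_iff hi i.exact_map_mkQ_range
      (Submodule.mkQ_surjective _) d).1 hd
    exact .left hi i.exact_map_mkQ_range (Submodule.mkQ_surjective _) (hR.pi n) (ih hC)

/-- Over a noetherian ring, the projective dimension of a finitely generated module is detected
by finitely generated modules. -/
theorem hasProjectiveDimensionLE_of_ext [Module.Finite R M] (d : ℕ)
    (h : ∀ (Y : Type u) [AddCommGroup Y] [Module R Y] [Module.Finite R Y],
      Subsingleton (Ext.{u} (ModuleCat.of R M) (ModuleCat.of R Y) (d + 1))) :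
    HasProjectiveDimensionLE (ModuleCat.of R M) d := by
  induction d generalizing M with
  | zero =>
    obtain ⟨n, p, hp⟩ := Module.Finite.exists_fin' R M
    have hx := LinearMap.shortExact_shortComplexKer hp
    have := h (LinearMap.ker p)
    -- The obstruction to lifting the identity of `M` through `p` lies in Ext¹(M, ker p) = 0, so `p`
    -- splits.
    obtain ⟨s, hs⟩ := Ext.covariant_sequence_exact₃ (ModuleCat.of R M) hx
      (Ext.mk₀ (𝟙 (ModuleCat.of R M))) (zero_add 1) (Subsingleton.elim (α := Ext.{u}
        (ModuleCat.of R M) (ModuleCat.of R (LinearMap.ker p)) 1) _ _)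
    obtain ⟨s, rfl⟩ := (Ext.mk₀_bijective _ _).2 s
    rw [Ext.mk₀_comp_mk₀] at hs
    have hs := congrArg ModuleCat.Hom.hom ((Ext.mk₀_bijective _ _).1 hs)
    exact projective_iff_hasProjectiveDimensionLE_zero.1 (Module.Projective.of_split s.hom p hs)
  | succ d ih =>
    obtain ⟨n, p, hp⟩ := Module.Finite.exists_fin' R M
    refine (hasProjectiveDimensionLE_succ_iff (LinearMap.ker p).injective_subtype
      p.exact_subtype_ker_map hp d).2 (ih fun Y _ _ _ ↦ ?_)
    have hx := LinearMap.shortExact_shortComplexKer hp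
    have h2 : Projective p.shortComplexKer.X₂ :=
      inferInstanceAs (Projective (ModuleCat.of R (Fin n → R)))
    have := h Y
    refine subsingleton_of_forall_eq 0 fun e ↦ ?_
    obtain ⟨x, hx⟩ := Ext.contravariant_sequence_exact₁ hx (ModuleCat.of R Y) e (add_comm 1 (d + 1))
      (Subsingleton.elim (α := Ext.{u} (ModuleCat.of R M) (ModuleCat.of R Y) (d + 1 + 1)) _ _)
    rw [← hx, Ext.eq_zero_of_projective x]
    exact Ext.comp_zero _ _ _ _ _

end Noetherian

/-! ### Shifting Ext along an embedding into an injective module. -/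

section DimensionShift

variable {f : M →ₗ[R] N} {g : N →ₗ[R] P} (hf : Function.Injective f)
  (hfg : Function.Exact f g) (hg : Function.Surjective g) [Module.Injective R N]
  (X : Type u) [AddCommGroup X] [Module R X]
include hf hfg hg

/-- As `N` is injective, Ext¹(X, M) is the cokernel of Hom(X, N) → Hom(X, P). Phrasing its vanishing
through Hom alone allows a comparison over two rings. -/
lemma subsingleton_ext_one_iff_lift :
    Subsingleton (Ext.{u} (ModuleCat.of R X) (ModuleCat.of R M) 1) ↔
      ∀ φ : X →ₗ[R] P, ∃ ψ : X →ₗ[R] N, g ∘ₗ ψ = φ := by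
  have hx := shortExact_of_exact hf hfg hg
  have h2 : Injective (ModuleCat.of R N) :=
    (Module.injective_iff_injective_object R N).1 inferInstance
  constructor
  · intro h φ
    obtain ⟨s, hs⟩ := Ext.covariant_sequence_exact₃ (ModuleCat.of R X) hx
      (Ext.mk₀ (ModuleCat.ofHom φ)) (zero_add 1) (Subsingleton.elim (α := Ext.{u}
        (ModuleCat.of R X) (ModuleCat.of R M) 1) _ _)
    obtain ⟨s, rfl⟩ := (Ext.mk₀_bijective _ _).2 s
    rw [Ext.mk₀_comp_mk₀] at hs
    exact ⟨s.hom, congrArg ModuleCat.Hom.hom ((Ext.mk₀_bijective _ _).1 hs)⟩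
  · intro h
    refine subsingleton_of_forall_eq 0 fun e ↦ ?_
    obtain ⟨φ, rfl⟩ := Ext.covariant_sequence_exact₁ (ModuleCat.of R X) hx e
      (Ext.eq_zero_of_injective (I := ModuleCat.of R N) _) (zero_add 1)
    obtain ⟨φ, rfl⟩ := (Ext.mk₀_bijective _ _).2 φ
    obtain ⟨ψ, hψ⟩ := h φ.hom
    have : φ = ModuleCat.ofHom ψ ≫ ModuleCat.ofHom g := by
      rw [← ModuleCat.ofHom_comp, hψ]; rfl
    rw [this, ← Ext.mk₀_comp_mk₀, Ext.comp_assoc_of_second_deg_zero]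
    erw [hx.comp_extClass]
    exact Ext.comp_zero _ _ _ _ _

lemma subsingleton_ext_succ_iff (i : ℕ) :
    Subsingleton (Ext.{u} (ModuleCat.of R X) (ModuleCat.of R M) (i + 2)) ↔
      Subsingleton (Ext.{u} (ModuleCat.of R X) (ModuleCat.of R P) (i + 1)) := by
  have hx := shortExact_of_exact hf hfg hg
  have h2 : Injective (ModuleCat.of R N) :=
    (Module.injective_iff_injective_object R N).1 inferInstance
  constructor
  · intro h
    refine subsingleton_of_forall_eq 0 fun e ↦ ?_
    obtain ⟨x, hx⟩ := Ext.covariant_sequence_exact₃ (ModuleCat.of R X) hx e rfl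
      (Subsingleton.elim (α := Ext.{u} (ModuleCat.of R X) (ModuleCat.of R M) (i + 2)) _ _)
    rw [← hx, Ext.eq_zero_of_injective (I := ModuleCat.of R N) x]
    exact Ext.zero_comp (X := ModuleCat.of R X) _ _ _ _
  · intro h
    refine subsingleton_of_forall_eq 0 fun e ↦ ?_
    obtain ⟨x, rfl⟩ := Ext.covariant_sequence_exact₁ (ModuleCat.of R X) hx e
      (Ext.eq_zero_of_injective (I := ModuleCat.of R N) _) rfl
    rw [Subsingleton.elim (α := Ext.{u} (ModuleCat.of R X) (ModuleCat.of R P) (i + 1)) x 0]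
    exact Ext.zero_comp (X := ModuleCat.of R X) _ _ _ _

end DimensionShift

end Dimensions

/-! ### Matlis duality over commutative artinian rings -/

/-! ### Injective hulls. -/

section Essential

variable {R : Type u} [Ring R]

lemma exists_maximal_disjoint {J : Type*} [AddCommGroup J] [Module R J]
    {D N : Submodule R J} (h : Disjoint D N) :
    ∃ C, D ≤ C ∧ Maximal (fun C ↦ Disjoint C N) C := by
  refine zorn_le_nonempty₀ {C | Disjoint C N} (fun c hc hchain y hy ↦
    ⟨sSup c, ?_, fun z hz ↦ le_sSup hz⟩) D h
  rw [Set.mem_ofPred_eq, Submodule.disjoint_def]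
  intro x hx hxN
  obtain ⟨z, hz, hxz⟩ := (Submodule.mem_sSup_of_directed ⟨y, hy⟩ hchain.directedOn).1 hx
  exact Submodule.disjoint_def.1 (hc hz) x hxz hxN

/-- Existence of injective hulls. -/
theorem exists_injective_essential (M : Type u) [AddCommGroup M] [Module R M] :
    ∃ (E : Type u) (_ : AddCommGroup E) (_ : Module R E) (i : M →ₗ[R] E),
      Module.Injective R E ∧ Function.Injective i ∧
        ∀ W : Submodule R E, Disjoint W (LinearMap.range i) → W = ⊥ := by
  obtain ⟨J, _, f, _⟩ := EnoughInjectives.presentation (ModuleCat.of R M)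
  have hJ : Module.Injective R J := (Module.injective_iff_injective_object R J).2 ‹_›
  have hf : Function.Injective f.hom := (ModuleCat.mono_iff_injective f).1 ‹_›
  -- `C` is maximal disjoint from the image of `M`, and `E` is maximal disjoint from `C` among
  -- submodules containing that image. `E` will be the hull, with `C` as a complement in `J`.
  obtain ⟨C, -, hC⟩ := exists_maximal_disjoint (disjoint_bot_left (a := LinearMap.range f.hom))
  obtain ⟨E, hE₀, hE⟩ := exists_maximal_disjoint hC.1.symm
  have hCE : ∀ C', C ≤ C' → Disjoint C' E → C' = C := fun C' h h' ↦
    (hC.eq_of_le (h'.mono_right hE₀) h).symm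
  let p : E →ₗ[R] J ⧸ C := C.mkQ ∘ₗ E.subtype
  have hp : Function.Injective p := by
    rw [← LinearMap.ker_eq_bot, eq_bot_iff]
    intro x hx
    have hx : (x : J) ∈ C := by simpa [p] using hx
    exact Subtype.ext (Submodule.disjoint_def.1 hE.1 _ x.2 hx)
  have hess : ∀ W : Submodule R (J ⧸ C), Disjoint W (LinearMap.range p) → W = ⊥ := by
    intro W hW
    have h1 := hCE (W.comap C.mkQ) (fun x hx ↦ by
      have : C.mkQ x = 0 := by simpa using hx
      simp [this]) (by
      rw [Submodule.disjoint_def]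
      intro x hx hxE
      have h2 : p ⟨x, hxE⟩ = 0 := Submodule.disjoint_def.1 hW _ hx ⟨⟨x, hxE⟩, rfl⟩
      exact congrArg Subtype.val (hp (h2.trans (map_zero p).symm)))
    rw [eq_bot_iff]
    intro w hw
    obtain ⟨x, rfl⟩ := C.mkQ_surjective w
    have : x ∈ W.comap C.mkQ := hw
    rw [h1] at this
    simpa using this
  -- By essentiality of `E` in `J ⧸ C`, the range of `q` is still disjoint from `C`; maximality of
  -- `E` then forces it to be `E`, so `q` retracts `J` onto `E`.
  obtain ⟨q, hq⟩ := Module.Injective.extension_property R J E (J ⧸ C) p hp E.subtype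
  have hq' : ∀ e : E, q (p e) = e := fun e ↦ LinearMap.congr_fun hq e
  have hker : LinearMap.ker q = ⊥ := hess _ (by
    rw [Submodule.disjoint_def]
    rintro _ hx ⟨e, rfl⟩
    have h2 : (e : J) = 0 := (hq' e).symm.trans hx
    rw [Subtype.ext (a1 := e) (a2 := 0) h2, map_zero])
  have hrange : LinearMap.range q = E := by
    have hle : E ≤ LinearMap.range q := fun x hx ↦ ⟨p ⟨x, hx⟩, hq' ⟨x, hx⟩⟩
    refine (hE.eq_of_le ?_ hle).symm
    rw [Submodule.disjoint_def]
    rintro _ ⟨y, rfl⟩ hy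
    have h3 : y ∈ Submodule.comap q C := hy
    have h4 := hess (Submodule.comap q C) (by
      rw [Submodule.disjoint_def]
      rintro _ hx ⟨e, rfl⟩
      have h5 : (e : J) ∈ C := by rw [← hq' e]; exact hx
      have h6 := Submodule.disjoint_def.1 hE.1 _ e.2 h5
      rw [Subtype.ext (a1 := e) (a2 := 0) h6, map_zero])
    rw [h4, Submodule.mem_bot] at h3
    rw [h3, map_zero]
  -- `E` is a direct summand of `J`
  let r : J →ₗ[R] E := LinearMap.codRestrict E (q ∘ₗ C.mkQ) fun x ↦ by
    rw [← hrange]; exact ⟨_, rfl⟩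
  have hr : ∀ e : E, r e = e := fun e ↦ Subtype.ext (hq' e)
  refine ⟨E, inferInstance, inferInstance, LinearMap.codRestrict E f.hom fun x ↦ hE₀ ⟨x, rfl⟩,
    ⟨fun X Y _ _ _ _ g hg φ ↦ ?_⟩, fun x y h ↦ hf (congrArg Subtype.val h), fun W hW ↦ ?_⟩
  · obtain ⟨ψ, hψ⟩ := hJ.out g hg (E.subtype ∘ₗ φ)
    exact ⟨r ∘ₗ ψ, fun x ↦ by rw [LinearMap.comp_apply, hψ]; exact hr _⟩
  · have hWE : W.map E.subtype ≤ E := Submodule.map_subtype_le E W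
    -- Adding `W` to `C` keeps it disjoint from the image of `M`, so maximality of `C` puts `W`
    -- inside `C ∩ E = 0`.
    have h1 : Disjoint (C ⊔ W.map E.subtype) (LinearMap.range f.hom) := by
      rw [Submodule.disjoint_def]
      rintro _ hx ⟨m, rfl⟩
      obtain ⟨c, hc, w, hw, hcw⟩ := Submodule.mem_sup.1 hx
      have hm := hE₀ ⟨m, rfl⟩
      have hc0 : c = 0 := Submodule.disjoint_def.1 hE.1 c (by
        rw [← add_sub_cancel_right c w, hcw]
        exact E.sub_mem hm (hWE hw)) hc
      rw [hc0, zero_add] at hcw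
      obtain ⟨w, hw, rfl⟩ := hw
      have := Submodule.disjoint_def.1 hW w hw ⟨m, Subtype.ext hcw.symm⟩
      rw [← hcw, this]
      rfl
    have h2 := hC.eq_of_le h1 le_sup_left
    rw [eq_bot_iff]
    intro w hw
    have h3 : (w : J) ∈ C := by
      rw [h2]; exact Submodule.mem_sup_right ⟨w, hw, rfl⟩
    exact Subtype.ext (Submodule.disjoint_def.1 hE.1 _ w.2 h3)

end Essential

section Matlis

/-- A dualizing module over a commutative ring: `Hom(-, E)` is a duality of modules of finite
length. -/
structure IsDualizing (k : Type u) [CommRing k] (E : Type u) [AddCommGroup E] [Module k E] :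
    Prop where
  injective : Module.Injective k E
  finite : ∀ (M : Type u) [AddCommGroup M] [Module k M] [Module.Finite k M],
    Module.Finite k (M →ₗ[k] E)
  bijective : ∀ (M : Type u) [AddCommGroup M] [Module k M] [Module.Finite k M],
    Function.Bijective (LinearMap.applyₗ : M →ₗ[k] (M →ₗ[k] E) →ₗ[k] E)

variable {k : Type u} [CommRing k] {E : Type u} [AddCommGroup E] [Module k E]

/-- The annihilator of `m ≠ 0` lies in a maximal ideal, so `m` can be sent to a nonzero element of
`E` killed by that ideal; injectivity extends this functional to `M`. -/
lemma injective_apply_of_cogenerator [Module.Injective k E]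
    (hE : ∀ I : Ideal k, I.IsMaximal → ∃ x : E, x ≠ 0 ∧ ∀ a ∈ I, a • x = 0)
    (M : Type*) [AddCommGroup M] [Module k M] :
    Function.Injective (LinearMap.applyₗ : M →ₗ[k] (M →ₗ[k] E) →ₗ[k] E) := by
  rw [← LinearMap.ker_eq_bot, eq_bot_iff]
  intro m hm
  by_contra hm0
  let I := LinearMap.ker (LinearMap.toSpanSingleton k M m)
  have hI : I ≠ ⊤ := fun h ↦ hm0 (by
    have : (1 : k) ∈ I := h ▸ Submodule.mem_top
    simpa [I] using this)
  obtain ⟨𝔪, hmax, hle⟩ := Ideal.exists_le_maximal I hI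
  obtain ⟨x, hx0, hx⟩ := hE 𝔪 hmax
  let e := (LinearMap.toSpanSingleton k M m).quotKerEquivRange
  let g : LinearMap.range (LinearMap.toSpanSingleton k M m) →ₗ[k] E :=
    (I.liftQ (LinearMap.toSpanSingleton k E x) fun a ha ↦ by simpa using hx a (hle ha)) ∘ₗ
      e.symm.toLinearMap
  obtain ⟨h, hh⟩ := Module.Injective.extension_property k E _ M
    (LinearMap.range (LinearMap.toSpanSingleton k M m)).subtype
    (Submodule.injective_subtype _) g
  have h1 : h m = g ⟨m, ⟨1, by simp⟩⟩ := LinearMap.congr_fun hh ⟨m, ⟨1, by simp⟩⟩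
  have h2 : e.symm ⟨m, ⟨1, by simp⟩⟩ = I.mkQ 1 := by
    rw [LinearEquiv.symm_apply_eq]
    exact Subtype.ext (by
      change m = (1 : k) • m
      rw [one_smul])
  have h3 : g ⟨m, ⟨1, by simp⟩⟩ = x := by
    dsimp only [g]
    rw [LinearMap.comp_apply, LinearEquiv.coe_coe, h2]
    exact one_smul k x
  have h4 : h m = 0 := LinearMap.congr_fun hm h
  exact hx0 (by rw [← h3, ← h1, h4])

/-- Hom(k/I, E) is the `I`-torsion of `E`, which the hypothesis makes zero or simple. Induction
along a composition series concludes, since Hom(-, E) is exact. -/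
lemma length_hom_le_of_socle [Module.Injective k E]
    (hE : ∀ I : Ideal k, I.IsMaximal → ∀ x y : E, (∀ a ∈ I, a • x = 0) → (∀ a ∈ I, a • y = 0) →
      x ≠ 0 → ∃ c : k, c • x = y)
    {M : Type*} [AddCommGroup M] [Module k M] (hM : IsFiniteLength k M) :
    Module.length k (M →ₗ[k] E) ≤ Module.length k M := by
  induction hM with
  | of_subsingleton => rw [Module.length_eq_zero]; exact zero_le
  | @of_simple_quotient M _ _ N _ _ ih =>
    have h1 : Module.length k ((M ⧸ N) →ₗ[k] E) ≤ 1 := by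
      rcases subsingleton_or_nontrivial ((M ⧸ N) →ₗ[k] E) with h | h
      · rw [Module.length_eq_zero]; exact zero_le
      · have : IsSimpleModule k ((M ⧸ N) →ₗ[k] E) := by
          rw [isSimpleModule_iff_toSpanSingleton_surjective]
          refine ⟨h, fun f hf g ↦ ?_⟩
          have := IsSimpleModule.nontrivial k (M ⧸ N)
          obtain ⟨t, ht⟩ := exists_ne (0 : M ⧸ N)
          have hsurj := IsSimpleModule.toSpanSingleton_surjective k ht
          have hmax : Ideal.IsMaximal (LinearMap.ker (LinearMap.toSpanSingleton k (M ⧸ N) t)) :=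
            IsSimpleModule.ker_toSpanSingleton_isMaximal k ht
          have hann : ∀ φ : (M ⧸ N) →ₗ[k] E,
              ∀ a ∈ LinearMap.ker (LinearMap.toSpanSingleton k (M ⧸ N) t), a • φ t = 0 := by
            intro φ a ha
            have : a • t = 0 := ha
            rw [← map_smul, this, map_zero]
          obtain ⟨c, hc⟩ := hE _ hmax (f t) (g t) (hann f) (hann g) (fun h0 ↦ hf (by
            ext x
            obtain ⟨a, ha⟩ := hsurj (N.mkQ x)
            have ha : a • t = N.mkQ x := ha
            simp only [LinearMap.comp_apply, ← ha, map_smul, h0, smul_zero, LinearMap.zero_apply]))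
          refine ⟨c, ?_⟩
          ext x
          obtain ⟨a, ha⟩ := hsurj (N.mkQ x)
          have ha : a • t = N.mkQ x := ha
          simp only [LinearMap.comp_apply, ← ha, map_smul, ← hc, LinearMap.toSpanSingleton_apply,
            LinearMap.smul_apply]
        rw [Module.length_eq_one]
    have h2 := Module.length_eq_add_of_exact (LinearMap.lcomp k E N.mkQ)
      (LinearMap.lcomp k E N.subtype)
      (fun f g h ↦ by ext x; exact LinearMap.congr_fun h x)
      (fun f ↦ by
        obtain ⟨g, hg⟩ := Module.Injective.extension_property k E _ _ N.subtype
          N.injective_subtype f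
        exact ⟨g, hg⟩)
      (fun f ↦ ⟨fun h ↦ ⟨N.liftQ f fun x hx ↦ LinearMap.congr_fun h ⟨x, hx⟩, by ext; rfl⟩, by
        rintro ⟨g, rfl⟩
        ext x
        have : N.mkQ x = 0 := by simp
        change g (N.mkQ x) = 0
        rw [this, map_zero]⟩)
    have h3 := Module.length_eq_add_of_exact N.subtype N.mkQ N.injective_subtype
      N.mkQ_surjective (LinearMap.exact_subtype_mkQ N)
    rw [h2, h3, add_comm, Module.length_eq_one k (M ⧸ N)]
    exact add_le_add ih h1

/-- A commutative artinian ring has a dualizing module: the injective hull of the direct sum of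
the simple modules. -/
theorem exists_isDualizing (k : Type u) [CommRing k] [IsArtinianRing k] :
    ∃ (E : Type u) (_ : AddCommGroup E) (_ : Module k E), IsDualizing k E := by
  classical
  obtain ⟨E, _, _, i, hinj, hi, hess⟩ :=
    exists_injective_essential (R := k) (∀ I : MaximalSpectrum k, k ⧸ I.asIdeal)
  have hcogen : ∀ I : Ideal k, I.IsMaximal → ∃ x : E, x ≠ 0 ∧ ∀ a ∈ I, a • x = 0 := by
    intro I hI
    refine ⟨i (Pi.single ⟨I, hI⟩ 1), fun h ↦ ?_, fun a ha ↦ ?_⟩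
    · rw [map_eq_zero_iff i hi, Pi.single_eq_zero_iff] at h
      exact one_ne_zero h
    · rw [← map_smul, ← Pi.single_smul, Algebra.smul_def, mul_one,
        Ideal.Quotient.algebraMap_eq, Ideal.Quotient.eq_zero_iff_mem.2 ha, Pi.single_zero, map_zero]
  have hsoc : ∀ I : Ideal k, I.IsMaximal → ∀ x y : E, (∀ a ∈ I, a • x = 0) →
      (∀ a ∈ I, a • y = 0) → x ≠ 0 → ∃ c : k, c • x = y := by
    intro I hI
    -- the `I`-torsion lies in the image of the sum of the simple modules
    have hmem : ∀ x : E, (∀ a ∈ I, a • x = 0) →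
        ∃ s : k ⧸ I, x = i (Pi.single (⟨I, hI⟩ : MaximalSpectrum k) s) := by
      intro x hx
      by_cases hx0 : x = 0
      · exact ⟨0, by simp [hx0]⟩
      have h1 : ¬ Disjoint (k ∙ x) (LinearMap.range i) := fun h ↦ hx0 (by
        simpa using hess _ h)
      rw [Submodule.disjoint_def] at h1
      push Not at h1
      obtain ⟨z, hz, ⟨w, rfl⟩, hw0⟩ := h1
      obtain ⟨a, ha⟩ := Submodule.mem_span_singleton.1 hz
      have haI : a ∉ I := fun h ↦ hw0 (by rw [← ha, hx a h])
      obtain ⟨b, hb⟩ := Ideal.IsMaximal.exists_inv hI haI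
      obtain ⟨c, hc, hbc⟩ := hb
      have hxw : x = i (b • w) := by
        rw [map_smul, ← ha, smul_smul]
        nth_rw 1 [← one_smul k x]
        rw [← hbc, add_smul, hx c hc, add_zero]
      refine ⟨(b • w) ⟨I, hI⟩, ?_⟩
      rw [hxw]
      congr 1
      ext J
      by_cases hJ : J = ⟨I, hI⟩
      · subst hJ; rw [Pi.single_eq_same]
      rw [Pi.single_eq_of_ne hJ]
      obtain ⟨d, hdI, hdJ⟩ : ∃ d ∈ I, d ∉ J.asIdeal := by
        by_contra! h
        exact hJ (MaximalSpectrum.ext (hI.eq_of_le J.isMaximal.ne_top h).symm)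
      have h2 : d • (b • w) = 0 := hi (by rw [map_smul, ← hxw, hx d hdI, map_zero])
      have h3 : Ideal.Quotient.mk J.asIdeal d * (b • w) J = 0 := by
        rw [← Ideal.Quotient.algebraMap_eq, ← Algebra.smul_def]
        exact congrFun h2 J
      have := J.isMaximal
      exact (mul_eq_zero.1 h3).resolve_left (by rwa [Ideal.Quotient.eq_zero_iff_mem])
    intro x y hx hy hx0
    obtain ⟨s, rfl⟩ := hmem x hx
    obtain ⟨t, rfl⟩ := hmem y hy
    let _ := Ideal.Quotient.field I
    have hs : s ≠ 0 := by rintro rfl; simp at hx0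
    obtain ⟨c, hc⟩ := Ideal.Quotient.mk_surjective (t / s)
    refine ⟨c, ?_⟩
    rw [← map_smul, ← Pi.single_smul, Algebra.smul_def, Ideal.Quotient.algebraMap_eq, hc,
      div_mul_cancel₀ t hs]
  have hlen := fun (M : Type u) [AddCommGroup M] [Module k M] (hM : IsFiniteLength k M) ↦
    length_hom_le_of_socle hsoc hM
  have hfin : ∀ (M : Type u) [AddCommGroup M] [Module k M] [Module.Finite k M],
      IsFiniteLength k M := fun M _ _ _ ↦ Module.length_ne_top_iff.1 Module.length_ne_top
  have hfin' : ∀ (M : Type u) [AddCommGroup M] [Module k M] [Module.Finite k M],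
      IsFiniteLength k (M →ₗ[k] E) := fun M _ _ _ ↦ Module.length_ne_top_iff.1
        (ne_top_of_le_ne_top Module.length_ne_top (hlen M (hfin M)))
  refine ⟨E, inferInstance, inferInstance, hinj, fun M _ _ _ ↦ ?_, fun M _ _ _ ↦ ?_⟩
  · have := (isFiniteLength_iff_isNoetherian_isArtinian.1 (hfin' M)).1
    infer_instance
  · have h1 := injective_apply_of_cogenerator hcogen M
    refine ⟨h1, ?_⟩
    let f : M →ₗ[k] (M →ₗ[k] E) →ₗ[k] E := LinearMap.applyₗ
    have h2 := Module.length_eq_add_of_exact f (LinearMap.range f).mkQ h1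
      (Submodule.mkQ_surjective _) f.exact_map_mkQ_range
    -- The bidual contains `M` and is no longer than `M`, so the cokernel has length zero.
    have h3 : Module.length k ((M →ₗ[k] E) →ₗ[k] E) ≤ Module.length k M :=
      (hlen _ (hfin' M)).trans (hlen M (hfin M))
    have h4 : Module.length k (((M →ₗ[k] E) →ₗ[k] E) ⧸ LinearMap.range f) = 0 := by
      have h5 : Module.length k M ≠ ⊤ := Module.length_ne_top
      rw [h2] at h3
      revert h3
      generalize Module.length k M = a at h5
      generalize Module.length k (((M →ₗ[k] E) →ₗ[k] E) ⧸ LinearMap.range f) = b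
      intro h3
      have h6 : a + b ≤ a + 0 := by simpa using h3
      simpa using (ENat.add_le_add_iff_left h5).1 h6
    rw [Module.length_eq_zero_iff, Submodule.Quotient.subsingleton_iff] at h4
    exact LinearMap.range_eq_top.1 h4

end Matlis

/-! ### Duality for modules over an artin algebra -/

section Duality

open MulOpposite

variable (k : Type u) [CommRing k] (R : Type u) [Ring R] [Algebra k R]
  (E : Type u) [AddCommGroup E] [Module k E]

/-- The module `Hom_k(R, E)` over the `k`-algebra `R`. -/
def RegularDual : Type u := R →ₗ[k] E

namespace RegularDual

instance : AddCommGroup (RegularDual k R E) := inferInstanceAs (AddCommGroup (R →ₗ[k] E))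

instance : Module k (RegularDual k R E) := inferInstanceAs (Module k (R →ₗ[k] E))

variable {k R E} in
/-- The underlying linear map. -/
def hom (f : RegularDual k R E) : R →ₗ[k] E := f

variable {k R E} in
lemma ext {f g : RegularDual k R E} (h : ∀ x, f.hom x = g.hom x) : f = g := LinearMap.ext h

instance : Module R (RegularDual k R E) where
  smul r f := f.hom ∘ₗ LinearMap.mulRight k r
  one_smul f := ext fun x ↦ congrArg f.hom (mul_one x)
  mul_smul r s f := ext fun x ↦ congrArg f.hom (mul_assoc x r s).symm
  smul_zero _ := LinearMap.zero_comp _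
  smul_add _ _ _ := LinearMap.add_comp _ _ _
  add_smul r s f := ext fun x ↦
    (congrArg f.hom (mul_add x r s)).trans (map_add f.hom _ _)
  zero_smul f := ext fun x ↦
    (congrArg f.hom (mul_zero x)).trans (map_zero f.hom)

variable {k R E}

instance : IsScalarTower k R (RegularDual k R E) :=
  .of_algebraMap_smul fun c f ↦ ext fun x ↦ by
    change f.hom (x * algebraMap k R c) = c • f.hom x
    rw [← Algebra.commutes, ← Algebra.smul_def, map_smul]

/-- The map to `Hom_k(R, E)` corresponding to a `k`-linear map to `E`. -/
def lift {X : Type*} [AddCommGroup X] [Module R X] [Module k X] [IsScalarTower k R X]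
    (g : X →ₗ[k] E) : X →ₗ[R] RegularDual k R E where
  toFun x := g ∘ₗ (LinearMap.toSpanSingleton R X x).restrictScalars k
  map_add' x y := ext fun r ↦ by
    change g (r • (x + y)) = g (r • x) + g (r • y)
    rw [smul_add, map_add]
  map_smul' s x := ext fun r ↦ by
    exact congrArg g (mul_smul r s x).symm

lemma lift_apply {X : Type*} [AddCommGroup X] [Module R X] [Module k X] [IsScalarTower k R X]
    (g : X →ₗ[k] E) (x : X) (r : R) : (lift g x).hom r = g (r • x) := rfl

/-- Evaluation at `1`. -/
def evalOne : RegularDual k R E →ₗ[k] E := LinearMap.applyₗ (1 : R)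

lemma evalOne_smul (f : RegularDual k R E) (r : R) :
    evalOne (r • f) = f.hom r := congrArg f.hom (one_mul r)

/-- Coinduction is right adjoint to the exact restriction of scalars: Hom_R(X, Hom_k(R, E)) =
Hom_k(X, E). -/
instance [Module.Injective k E] : Module.Injective R (RegularDual k R E) :=
  ⟨fun X Y _ _ _ _ f hf φ ↦ by
    let _ : Module k X := Module.compHom X (algebraMap k R)
    let _ : Module k Y := Module.compHom Y (algebraMap k R)
    have : IsScalarTower k R X := .of_algebraMap_smul fun _ _ ↦ rfl
    have : IsScalarTower k R Y := .of_algebraMap_smul fun _ _ ↦ rfl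
    obtain ⟨g, hg⟩ := Module.Injective.extension_property k E X Y (f.restrictScalars k) hf
      (evalOne ∘ₗ φ.restrictScalars k)
    refine ⟨lift g, fun x ↦ ext fun r ↦ ?_⟩
    rw [lift_apply, ← map_smul, ← evalOne_smul, ← map_smul φ]
    exact LinearMap.congr_fun hg (r • x)⟩

lemma finite [Module.Finite k R] (hE : IsDualizing k E) : Module.Finite R (RegularDual k R E) :=
  have : Module.Finite k (RegularDual k R E) := hE.finite R
  Module.Finite.of_restrictScalars_finite k R _

/-- Finitely many generators of Hom_k(X, E) suffice: an element they all kill is killed by every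
functional, hence is zero by biduality. -/
lemma exists_embedding [Module.Finite k R] (hE : IsDualizing k E) (X : Type u) [AddCommGroup X]
    [Module R X] [Module.Finite R X] :
    ∃ (n : ℕ) (f : X →ₗ[R] Fin n → RegularDual k R E), Function.Injective f := by
  let _ : Module k X := Module.compHom X (algebraMap k R)
  have : IsScalarTower k R X := .of_algebraMap_smul fun _ _ ↦ rfl
  have : Module.Finite k X := Module.Finite.trans R X
  have := hE.finite X
  obtain ⟨n, g, hg⟩ := Module.Finite.exists_fin (R := k) (M := X →ₗ[k] E)
  refine ⟨n, LinearMap.pi fun i ↦ lift (g i), ?_⟩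
  rw [← LinearMap.ker_eq_bot, eq_bot_iff]
  intro x hx
  have h1 : ∀ i, g i x = 0 := fun i ↦ by
    have := LinearMap.congr_fun (congrFun (LinearMap.mem_ker.1 hx) i) (1 : R)
    rw [← one_smul R x]
    exact this
  have h2 : (⊤ : Submodule k (X →ₗ[k] E)) ≤ LinearMap.ker (LinearMap.applyₗ x) := by
    rw [← hg, Submodule.span_le]
    rintro _ ⟨i, rfl⟩
    exact h1 i
  exact (hE.bijective X).1 ((LinearMap.ext fun f ↦ h2 Submodule.mem_top).trans
    (map_zero (LinearMap.applyₗ : X →ₗ[k] (X →ₗ[k] E) →ₗ[k] E)).symm)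

end RegularDual

variable (M N P : Type u) [AddCommGroup M] [Module R M] [Module k M] [IsScalarTower k R M]
  [AddCommGroup N] [Module R N] [Module k N] [IsScalarTower k R N]
  [AddCommGroup P] [Module R P] [Module k P] [IsScalarTower k R P]

/-- The right module `Hom_k(M, E)` dual to a left module `M`. -/
def RightDual : Type u :=
  -- Mentioning the tower makes `R` and its action on `M` parameters of the type, so that the right
  -- action can be found by instance search.
  have _ : IsScalarTower k R M := inferInstance
  M →ₗ[k] E

namespace RightDual

instance : AddCommGroup (RightDual k R E M) := inferInstanceAs (AddCommGroup (M →ₗ[k] E))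

variable {k R E M} in
/-- The underlying linear map. -/
def hom (f : RightDual k R E M) : M →ₗ[k] E := f

variable {k R E M} in
lemma ext {f g : RightDual k R E M} (h : ∀ x, f.hom x = g.hom x) : f = g := LinearMap.ext h

variable {k E M} in
/-- A linear map as an element of the dual. -/
def of (f : M →ₗ[k] E) : RightDual k R E M := f

instance : Module Rᵐᵒᵖ (RightDual k R E M) where
  smul r f := f.hom ∘ₗ (Algebra.lsmul k k M r.unop)
  one_smul f := ext fun x ↦ congrArg f.hom (one_smul R x)
  mul_smul r s f := ext fun x ↦ congrArg f.hom (mul_smul s.unop r.unop x)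
  smul_zero _ := LinearMap.zero_comp _
  smul_add _ _ _ := LinearMap.add_comp _ _ _
  add_smul r s f := ext fun x ↦
    (congrArg f.hom (add_smul r.unop s.unop x)).trans (map_add f.hom _ _)
  zero_smul f := ext fun x ↦
    (congrArg f.hom (zero_smul R x)).trans (map_zero f.hom)

variable {k R E M N P}

/-- The dual of a morphism of modules. -/
def map (f : M →ₗ[R] N) : RightDual k R E N →ₗ[Rᵐᵒᵖ] RightDual k R E M where
  toFun g := g.hom ∘ₗ (f.restrictScalars k)
  map_add' _ _ := LinearMap.add_comp _ _ _
  map_smul' r g := ext fun x ↦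
    (congrArg g.hom (map_smul f r.unop x)).symm

lemma map_injective {f : M →ₗ[R] N} (hf : Function.Surjective f) :
    Function.Injective (map f : RightDual k R E N →ₗ[Rᵐᵒᵖ] RightDual k R E M) := by
  intro g h hgh
  refine ext fun y ↦ ?_
  obtain ⟨x, rfl⟩ := hf y
  exact LinearMap.congr_fun (congrArg hom hgh) x

lemma map_surjective [Module.Injective k E] {f : M →ₗ[R] N} (hf : Function.Injective f) :
    Function.Surjective (map f : RightDual k R E N →ₗ[Rᵐᵒᵖ] RightDual k R E M) :=
  fun g ↦ Module.Injective.extension_property k E M N (f.restrictScalars k) hf g.hom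

lemma map_exact {f : M →ₗ[R] N} {g : N →ₗ[R] P} (hfg : Function.Exact f g)
    (hg : Function.Surjective g) :
    Function.Exact (map g : RightDual k R E P →ₗ[Rᵐᵒᵖ] RightDual k R E N)
      (map f : RightDual k R E N →ₗ[Rᵐᵒᵖ] RightDual k R E M) := by
  intro φ
  constructor
  · intro h
    have hle : LinearMap.ker (g.restrictScalars k) ≤ LinearMap.ker φ.hom := fun y hy ↦ by
      obtain ⟨x, rfl⟩ := (hfg y).1 hy
      exact LinearMap.congr_fun (congrArg hom h) x
    let e := (g.restrictScalars k).quotKerEquivOfSurjective hg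
    refine ⟨((LinearMap.ker (g.restrictScalars k)).liftQ φ.hom hle) ∘ₗ
      e.symm.toLinearMap, ext fun y ↦ ?_⟩
    have h1 : e.symm (g y) = (LinearMap.ker (g.restrictScalars k)).mkQ y := by
      rw [LinearEquiv.symm_apply_eq]; rfl
    change ((LinearMap.ker (g.restrictScalars k)).liftQ φ.hom hle) (e.symm (g y)) = _
    rw [h1]
    rfl
  · rintro ⟨ψ, rfl⟩
    refine ext fun x ↦ ?_
    have : g (f x) = 0 := (hfg _).2 ⟨x, rfl⟩
    change ψ.hom (g (f x)) = 0
    rw [this, map_zero]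

instance [Module.Injective k E] (n : ℕ) :
    Module.Injective Rᵐᵒᵖ (RightDual k R E (Fin n → R)) :=
  ⟨fun X Y _ _ _ _ f hf φ ↦ by
    let _ : Module k X := Module.compHom X (algebraMap k Rᵐᵒᵖ)
    let _ : Module k Y := Module.compHom Y (algebraMap k Rᵐᵒᵖ)
    have : IsScalarTower k Rᵐᵒᵖ X := .of_algebraMap_smul fun _ _ ↦ rfl
    have : IsScalarTower k Rᵐᵒᵖ Y := .of_algebraMap_smul fun _ _ ↦ rfl
    have h : ∀ j : Fin n, ∃ g : Y →ₗ[k] E, ∀ x, g (f x) = (φ x).hom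
        (Pi.single j 1) := fun j ↦ by
      obtain ⟨g, hg⟩ := Module.Injective.extension_property k E X Y (f.restrictScalars k) hf
        { toFun := fun x ↦ (φ x).hom (Pi.single j 1)
          map_add' := fun x y ↦ by rw [map_add]; rfl
          map_smul' := fun c x ↦ by
            have h1 : c • x = algebraMap k Rᵐᵒᵖ c • x := rfl
            rw [h1, map_smul]
            change (φ x).hom (algebraMap k R c • Pi.single j 1) = _
            rw [algebraMap_smul, map_smul]
            rfl }
      exact ⟨g, fun x ↦ LinearMap.congr_fun hg x⟩
    choose g hg using h
    let F (y : Y) : RightDual k R E (Fin n → R) := of R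
      { toFun := fun v ↦ ∑ j, g j (op (v j) • y)
        map_add' := fun v w ↦ by simp [add_smul, Finset.sum_add_distrib]
        map_smul' := fun c v ↦ by simp [Finset.smul_sum] }
    refine ⟨{ toFun := F, map_add' := fun x y ↦ ext fun v ↦ ?_,
              map_smul' := fun r y ↦ ext fun v ↦ ?_ }, fun x ↦ ext fun v ↦ ?_⟩
    · change ∑ j, g j (op (v j) • (x + y)) = ∑ j, g j (op (v j) • x) + ∑ j, g j (op (v j) • y)
      simp [Finset.sum_add_distrib]
    · change ∑ j, g j (op (v j) • r • y) = ∑ j, g j (op (r.unop * v j) • y)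
      simp [mul_smul]
    · change ∑ j, g j (op (v j) • f x) = _
      have h1 : ∀ j, g j (op (v j) • f x) = (φ x).hom (Pi.single j (v j)) := by
        intro j
        rw [← map_smul, hg, map_smul]
        change (φ x).hom (v j • Pi.single j 1) = _
        rw [← Pi.single_smul, smul_eq_mul, mul_one]
      rw [Finset.sum_congr rfl fun j _ ↦ h1 j]
      rw [← map_sum, Finset.univ_sum_single]⟩

variable [Module.Finite k R]

/-- Dualizing a presentation by `R^n`, a retraction `σ` of the dual of `p` corresponds to a section
of `p`. The value `s m` is the vector that represents `g ↦ σ g m` under biduality of `R^n`. -/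
lemma injective_iff_projective (hE : IsDualizing k E) [Module.Finite R M] :
    Module.Injective Rᵐᵒᵖ (RightDual k R E M) ↔ Module.Projective R M := by
  have := hE.injective
  obtain ⟨n, p, hp⟩ := Module.Finite.exists_fin' R M
  constructor
  · intro h
    obtain ⟨σ, hσ⟩ := Module.Injective.extension_property Rᵐᵒᵖ (RightDual k R E M) _ _
      (map p : RightDual k R E M →ₗ[Rᵐᵒᵖ] _) (map_injective hp) LinearMap.id
    have hb := hE.bijective (Fin n → R)
    have : Module.Finite k M := Module.Finite.trans R M
    have hM := hE.bijective M
    let σ' : (((Fin n → R) →ₗ[k] E)) →ₗ[k] M →ₗ[k] E :=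
      { toFun := fun g ↦ (σ (of R g)).hom
        map_add' := fun g h ↦ map_add σ (of R g) (of R h)
        map_smul' := fun c g ↦ by
          have h1 : of R (c • g) = op (algebraMap k R c) • of R g :=
            ext fun v ↦ by
              change c • g v = g (algebraMap k R c • v)
              rw [algebraMap_smul, map_smul]
          rw [h1]
          refine (congrArg hom (map_smul σ _ (of R g))).trans (LinearMap.ext fun v ↦ ?_)
          change (σ (of R g)).hom (algebraMap k R c • v) = c • (σ (of R g)).hom v
          rw [algebraMap_smul, map_smul] }
    have hex : ∀ m : M, ∃ v : Fin n → R, ∀ g : (Fin n → R) →ₗ[k] E, g v = σ' g m := fun m ↦ by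
      obtain ⟨v, hv⟩ := hb.2 (LinearMap.applyₗ m ∘ₗ σ')
      exact ⟨v, fun g ↦ LinearMap.congr_fun hv g⟩
    have huniq : ∀ v w : Fin n → R, (∀ g : (Fin n → R) →ₗ[k] E, g v = g w) → v = w :=
      fun v w h ↦ hb.1 (LinearMap.ext h)
    choose s hs using hex
    let s' : M →ₗ[R] Fin n → R :=
      { toFun := s
        map_add' := fun x y ↦ huniq _ _ fun g ↦ by rw [map_add, hs, hs, hs, map_add]
        map_smul' := fun r x ↦ huniq _ _ fun g ↦ by
          rw [hs, RingHom.id_apply]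
          have h2 := LinearMap.congr_fun (map_smul σ (op r) (of R g)) x
          exact h2.symm.trans (hs x (op r • of R g).hom).symm }
    refine Module.Projective.of_split s' p (LinearMap.ext fun m ↦ hM.1 (LinearMap.ext fun g ↦ ?_))
    change g (p (s m)) = g m
    have h3 := hs m (g ∘ₗ p.restrictScalars k)
    exact h3.trans (LinearMap.congr_fun (congrArg hom (LinearMap.congr_fun hσ (of R g))) m)
  · intro h
    obtain ⟨s, hs⟩ := Module.projective_lifting_property p LinearMap.id hp
    refine ⟨fun X Y _ _ _ _ f hf φ ↦ ?_⟩
    obtain ⟨ψ, hψ⟩ := Module.Injective.extension_property Rᵐᵒᵖ (RightDual k R E (Fin n → R)) _ _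
      f hf (map p ∘ₗ φ)
    refine ⟨map s ∘ₗ ψ, fun x ↦ ?_⟩
    have h1 : ψ (f x) = map p (φ x) := LinearMap.congr_fun hψ x
    rw [LinearMap.comp_apply, h1]
    exact ext fun m ↦ congrArg (φ x).hom (LinearMap.congr_fun hs m)

lemma hasInjectiveDimensionLE_iff [IsNoetherianRing R] (hE : IsDualizing k E)
    [Module.Finite R M] (d : ℕ) :
    HasInjectiveDimensionLE (ModuleCat.of Rᵐᵒᵖ (RightDual k R E M)) d ↔
      HasProjectiveDimensionLE (ModuleCat.of R M) d := by
  have := hE.injective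
  induction d generalizing M with
  | zero =>
    rw [← injective_iff_hasInjectiveDimensionLE_zero, injective_iff_projective hE,
      projective_iff_hasProjectiveDimensionLE_zero]
  | succ d ih =>
    obtain ⟨n, p, hp⟩ := Module.Finite.exists_fin' R M
    exact (hasInjectiveDimensionLE_succ_iff (map_injective hp)
      (map_exact p.exact_subtype_ker_map hp)
      (map_surjective (LinearMap.ker p).injective_subtype) d).trans (ih.trans
        (hasProjectiveDimensionLE_succ_iff (LinearMap.ker p).injective_subtype
          p.exact_subtype_ker_map hp d).symm)

variable (k R E) in
omit [Module.Finite k R] in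
/-- The biduality morphism of the regular module. -/
def regularEval : R →ₗ[Rᵐᵒᵖ] RightDual k R E (RegularDual k R E) where
  toFun x := of R (M := RegularDual k R E) (LinearMap.applyₗ x : (R →ₗ[k] E) →ₗ[k] E)
  map_add' x y := map_add (LinearMap.applyₗ : R →ₗ[k] (R →ₗ[k] E) →ₗ[k] E) x y
  map_smul' _ _ := rfl

/-- The biduality isomorphism of the regular module. -/
noncomputable def regularEquiv (hE : IsDualizing k E) :
    R ≃ₗ[Rᵐᵒᵖ] RightDual k R E (RegularDual k R E) :=
  LinearEquiv.ofBijective (regularEval k R E) (hE.bijective R)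

end RightDual

end Duality

/-- An algebra that is finite over a commutative artinian ring is finite over such a ring in the
universe of the algebra. -/
lemma exists_base (k : Type v) [CommRing k] [IsArtinianRing k] (R : Type u) [Ring R]
    [Algebra k R] [Module.Finite k R] :
    ∃ (K : Type u) (_ : CommRing K) (_ : Algebra K R), IsArtinianRing K ∧ Module.Finite K R := by
  -- The image of `k` in the centre is a quotient of `k`, hence artinian, and lives in the universe
  -- of `R`.
  let f := algebraMap k (Subalgebra.center k R)
  let K := f.range
  let g : K →+* R := (Subalgebra.center k R).val.toRingHom.comp K.subtype
  let _ : Algebra K R := g.toAlgebra' fun c x ↦ (Subalgebra.mem_center_iff.1 c.1.2 x).symm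
  refine ⟨K, inferInstance, inferInstance, f.rangeRestrict_surjective.isArtinianRing, ?_⟩
  let _ : Algebra k K := f.rangeRestrict.toAlgebra
  have : IsScalarTower k K R := .of_algebraMap_eq fun _ ↦ rfl
  exact Module.Finite.of_restrictScalars_finite k K R

/-- An artin algebra has a finitely generated injective cogenerator whose projective dimension
is finite if and only if the injective dimension of the regular right module is. -/
theorem exists_injective_cogenerator (k : Type v) [CommRing k] [IsArtinianRing k] (R : Type u)
    [Ring R] [Algebra k R] [Module.Finite k R] :
    ∃ (Q : Type u) (_ : AddCommGroup Q) (_ : Module R Q),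
      Module.Finite R Q ∧ Module.Injective R Q ∧
      (∀ (X : Type u) [AddCommGroup X] [Module R X] [Module.Finite R X],
        ∃ (n : ℕ) (f : X →ₗ[R] Fin n → Q), Function.Injective f) ∧
      ((∃ d : ℕ, HasInjectiveDimensionLE (ModuleCat.of Rᵐᵒᵖ R) d) ↔ FinProjDim R Q) := by
  obtain ⟨K, _, _, _, _⟩ := exists_base k R
  obtain ⟨E, _, _, hE⟩ := exists_isDualizing K
  have := hE.injective
  have := RegularDual.finite (R := R) hE
  have : IsNoetherianRing R := isNoetherian_of_tower K inferInstance
  refine ⟨RegularDual K R E, inferInstance, inferInstance, inferInstance, inferInstance,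
    fun X _ _ _ ↦ RegularDual.exists_embedding hE X, exists_congr fun d ↦ ?_⟩
  -- The right regular module is the dual of D(R) by biduality, and duality exchanges injective and
  -- projective dimension.
  rw [← RightDual.hasInjectiveDimensionLE_iff hE]
  let e := (RightDual.regularEquiv (R := R) hE).toModuleIso
  exact ⟨fun h ↦ hasInjectiveDimensionLT_of_iso e _, fun h ↦ hasInjectiveDimensionLT_of_iso e.symm _⟩

/-! ### Approximation of modules by the perpendicular category -/

/-! ### Finite powers of a simple module. -/

section Power

variable {A : Type u} [Ring A] {S : Type u} [AddCommGroup S] [Module A S]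

variable (A S) in
/-- The module `N` is isomorphic to a finite power of `S`. -/
def IsIsoPower (N : Type*) [AddCommGroup N] [Module A N] : Prop :=
  ∃ n : ℕ, Nonempty (N ≃ₗ[A] (Fin n → S))

namespace IsIsoPower

variable {N N' X : Type*} [AddCommGroup N] [Module A N] [AddCommGroup N'] [Module A N']
  [AddCommGroup X] [Module A X]

lemma isIsotypicOfType_fun [IsSimpleModule A S] (n : ℕ) :
    IsIsotypicOfType A (Fin n → S) S := by
  intro m hm
  obtain ⟨x, hx, hx0⟩ := m.ne_bot_iff.1 (fun h ↦ by
    subst h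
    exact not_nontrivial _ (IsSimpleModule.nontrivial A (⊥ : Submodule A (Fin n → S))))
  obtain ⟨j, hj⟩ := Function.ne_iff.1 hx0
  let f : m →ₗ[A] S := LinearMap.proj j ∘ₗ m.subtype
  have hf : f ≠ 0 := fun h ↦ hj (LinearMap.congr_fun h ⟨x, hx⟩)
  exact ⟨LinearEquiv.ofBijective f (LinearMap.bijective_of_ne_zero hf)⟩

lemma of_injective [IsSimpleModule A S] (hN : IsIsoPower A S N) (f : N' →ₗ[A] N)
    (hf : Function.Injective f) : IsIsoPower A S N' := by
  obtain ⟨n, ⟨e⟩⟩ := hN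
  let g : N' →ₗ[A] Fin n → S := e.toLinearMap ∘ₗ f
  have hg : Function.Injective g := e.injective.comp hf
  have : IsSemisimpleModule A N' := IsSemisimpleModule.of_injective g hg
  have : Module.Finite A N' := Module.Finite.of_injective g hg
  exact ((isIsotypicOfType_fun n).of_injective g hg).linearEquiv_fun

lemma of_surjective [IsSimpleModule A S] (hN : IsIsoPower A S N) (f : N →ₗ[A] N')
    (hf : Function.Surjective f) : IsIsoPower A S N' := by
  have hN' := hN
  obtain ⟨n, ⟨e⟩⟩ := hN'
  have : IsSemisimpleModule A N := IsSemisimpleModule.of_injective e.toLinearMap e.injective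
  obtain ⟨C, hC⟩ := exists_isCompl (LinearMap.ker f)
  let e' : N' ≃ₗ[A] C := (f.quotKerEquivOfSurjective hf).symm ≪≫ₗ
    Submodule.quotientEquivOfIsCompl _ _ hC
  exact hN.of_injective (C.subtype ∘ₗ e'.toLinearMap) (C.injective_subtype.comp e'.injective)

lemma of_surjective_of_ker [IsSimpleModule A S] {n : ℕ} (p : X →ₗ[A] (Fin n → S))
    (hp : Function.Surjective p) (r : X →ₗ[A] N) (hr : Function.Surjective r)
    (h : ∀ x, p x = 0 → r x = 0) : IsIsoPower A S N := by
  let e := p.quotKerEquivOfSurjective hp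
  refine IsIsoPower.of_surjective ⟨n, ⟨e⟩⟩ ((LinearMap.ker p).liftQ r fun x hx ↦ h x hx)
    fun y ↦ ?_
  obtain ⟨x, rfl⟩ := hr y
  exact ⟨(LinearMap.ker p).mkQ x, rfl⟩

lemma eq_zero (hN : IsIsoPower A S N) (hX : ∀ f : S →ₗ[A] X, f = 0) (f : N →ₗ[A] X) : f = 0 := by
  obtain ⟨n, ⟨e⟩⟩ := hN
  have h : f ∘ₗ e.symm.toLinearMap = 0 := LinearMap.pi_ext' fun j ↦ by
    rw [hX ((f ∘ₗ e.symm.toLinearMap) ∘ₗ LinearMap.single A (fun _ ↦ S) j),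
      LinearMap.zero_comp]
  ext x
  simpa using LinearMap.congr_fun h (e x)

variable {N : Type u} [AddCommGroup N] [Module A N]

lemma finInjDim (hN : IsIsoPower A S N) (hS : FinInjDim A S) : FinInjDim A N := by
  obtain ⟨n, ⟨e⟩⟩ := hN
  exact .of_equiv e (hS.pi n)

lemma finProjDim (hN : IsIsoPower A S N) (hS : FinProjDim A S) : FinProjDim A N := by
  obtain ⟨n, ⟨e⟩⟩ := hN
  exact .of_equiv e (hS.pi n)

end IsIsoPower

end Power

/-! ### Universal extension by copies of `S`, followed by removal of the trace of `S`. -/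

section Approximation

variable {A : Type u} [Ring A] {S : Type u} [AddCommGroup S] [Module A S]

/-- Every finitely generated module has a universal morphism to the perpendicular category, whose
kernel and cokernel are powers of `S`. -/
theorem exists_perp_approximation (k : Type v) [CommRing k] [IsArtinianRing k]
    [Algebra k A] [Module.Finite k A] (hS : IsLocalizable A S) (M : Type u) [AddCommGroup M]
    [Module A M] [Module.Finite A M] :
    ∃ (Y : Type u) (_ : AddCommGroup Y) (_ : Module A Y) (l : M →ₗ[A] Y), IsPerp A S Y ∧
      IsIsoPower A S (LinearMap.ker l) ∧ IsIsoPower A S (Y ⧸ LinearMap.range l) ∧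
      ∀ (Z : Type u) [AddCommGroup Z] [Module A Z], IsPerp A S Z →
        ∀ f : M →ₗ[A] Z, ∃! g : Y →ₗ[A] Z, g ∘ₗ l = f := by
  have := hS.simple
  have : IsNoetherianRing A := isNoetherian_of_tower k inferInstance
  have : Nontrivial S := IsSimpleModule.nontrivial A S
  obtain ⟨s, hs⟩ := exists_ne (0 : S)
  let π : A →ₗ[A] S := LinearMap.toSpanSingleton A S s
  have hπ : Function.Surjective π := IsSimpleModule.toSpanSingleton_surjective A hs
  let I := LinearMap.ker π
  let _ : Module k M := Module.compHom M (algebraMap k A)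
  have : IsScalarTower k A M := .of_algebraMap_smul fun _ _ ↦ rfl
  have : Module.Finite k M := Module.Finite.trans A M
  have hproj : Module.Projective A I := projective_ker hS hπ
  have hES := (subsingleton_ext_iff hπ S).1 hS.ext
  -- finitely many generators of `Hom(I, M)`
  have hfin : Module.Finite k (I →ₗ[A] M) := by
    have h1 : Module.Finite k I :=
      Module.Finite.of_injective (I.subtype.restrictScalars k) I.injective_subtype
    exact Module.Finite.of_injective (LinearMap.restrictScalarsₗ k A I M k)
      (LinearMap.restrictScalars_injective k)
  obtain ⟨m, f, hf⟩ := Module.Finite.exists_fin (R := k) (M := I →ₗ[A] M)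
  -- the universal extension `X'`
  let φ : (Fin m → I) →ₗ[A] M × (Fin m → A) := LinearMap.prod
    (∑ j, f j ∘ₗ LinearMap.proj j) (-(LinearMap.pi fun j ↦ I.subtype ∘ₗ LinearMap.proj j))
  let X' := (M × (Fin m → A)) ⧸ LinearMap.range φ
  let q : M × (Fin m → A) →ₗ[A] X' := (LinearMap.range φ).mkQ
  have hq : Function.Surjective q := Submodule.mkQ_surjective _
  have hφ : ∀ v : Fin m → I, q (∑ j, f j (v j), 0) = q (0, fun j ↦ (v j : A)) := by
    intro v
    rw [← sub_eq_zero, ← map_sub, ← LinearMap.mem_ker, Submodule.ker_mkQ]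
    refine ⟨v, ?_⟩
    ext <;> simp [φ, LinearMap.prod_apply]
  -- This says Ext¹(S, X') = 0. Lift `g` to M × A^m. Since Ext¹(S, S) = 0, subtracting right
  -- multiplication by some `a` moves the A^m-component into I^m, where it is glued to `M`. What
  -- remains is a map `I → M`, a combination `c` of the generators `f`, and each generator became
  -- trivial in `X'`.
  have hEX' : ∀ g : I →ₗ[A] X', ∃ x : X', ∀ i : I, g i = (i : A) • x := by
    intro g
    obtain ⟨g', hg'⟩ := Module.projective_lifting_property q g hq
    have h2 : ∀ j : Fin m, ∃ a : A, ∀ i : I, (g' i).2 j - (i : A) * a ∈ I := by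
      intro j
      obtain ⟨t, ht⟩ := hES (π ∘ₗ LinearMap.proj j ∘ₗ LinearMap.snd A M (Fin m → A) ∘ₗ g')
      obtain ⟨a, rfl⟩ := hπ t
      refine ⟨a, fun i ↦ ?_⟩
      have h3 := ht i
      simp only [LinearMap.comp_apply, LinearMap.proj_apply, LinearMap.snd_apply] at h3
      rw [LinearMap.mem_ker, map_sub, h3, sub_eq_zero, ← smul_eq_mul, map_smul]
    choose a ha using h2
    let w : I →ₗ[A] (Fin m → I) := LinearMap.pi fun j ↦ LinearMap.codRestrict I
      (LinearMap.proj j ∘ₗ LinearMap.snd A M (Fin m → A) ∘ₗ g' -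
        LinearMap.toSpanSingleton A A (a j) ∘ₗ I.subtype) (fun i ↦ by simpa using ha j i)
    let h : I →ₗ[A] M := LinearMap.fst A M (Fin m → A) ∘ₗ g' + ∑ j, f j ∘ₗ LinearMap.proj j ∘ₗ w
    have hh : h ∈ Submodule.span k (Set.range f) := by rw [hf]; trivial
    obtain ⟨c, hc⟩ := (Submodule.mem_span_range_iff_exists_fun k).1 hh
    refine ⟨q (0, a) + q (0, fun j ↦ c j • (1 : A)), fun i ↦ ?_⟩
    have e1 : g i = q (g' i) := by rw [← hg']; rfl
    have e2 : g' i = (i : A) • ((0, a) : M × (Fin m → A)) + (((g' i).1, 0) + (0, fun j ↦ (w i j : A))) := by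
      ext <;> simp [w]
    have e3 : q ((g' i).1, 0) + q (0, fun j ↦ (w i j : A)) = q (h i, 0) := by
      rw [← hφ, ← map_add]
      congr 1
      ext <;> simp [h]
    have e4 : (h i, (0 : Fin m → A)) = (∑ j, f j (c j • i), 0) := by
      rw [← hc]
      congr 1
      simp only [LinearMap.sum_apply, LinearMap.smul_apply]
      refine Finset.sum_congr rfl fun j _ ↦ ?_
      have : c j • i = (algebraMap k A (c j)) • i := (algebraMap_smul A (c j) i).symm
      rw [this, map_smul, algebraMap_smul]
    rw [e1, e2, map_add, map_add, map_smul, e3, e4, hφ (fun j ↦ c j • i), smul_add]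
    congr 1
    rw [← map_smul]
    congr 1
    ext <;> simp
  -- the quotient by the trace of `S`
  let T : Submodule A X' := isotypicComponent A X' S
  have hST : ∀ (g : S →ₗ[A] X') (s : S), g s ∈ T := by
    intro g s
    have h1 := LinearMap.le_comap_isotypicComponent S g
    have h2 : (⊤ : Submodule A S) ≤ isotypicComponent A S S :=
      le_sSup ⟨Submodule.topEquiv⟩
    exact h1 (h2 trivial)
  have hET : ∀ g : I →ₗ[A] T, ∃ x : T, ∀ i : I, g i = (i : A) • x := by
    intro g
    obtain ⟨n, ⟨e⟩⟩ := (IsIsotypicOfType.isotypicComponent A X' (S := S)).linearEquiv_fun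
    choose x hx using fun j ↦ hES (LinearMap.proj j ∘ₗ e.toLinearMap ∘ₗ g)
    refine ⟨e.symm x, fun i ↦ ?_⟩
    rw [← map_smul, LinearEquiv.eq_symm_apply]
    ext j
    exact hx j i
  let p : X' →ₗ[A] X' ⧸ T := T.mkQ
  have hp : Function.Surjective p := Submodule.mkQ_surjective _
  -- A map `S → X' ⧸ T` lifts to `X'` because Ext¹(S, T) = 0, and then lands in the trace `T`.
  -- Ext¹(S, -) is right exact because `I` is projective, so its vanishing passes from `X'` to the
  -- quotient.
  have hperp : IsPerp A S (X' ⧸ T) := by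
    refine ⟨inferInstance, fun g ↦ ?_, (subsingleton_ext_iff hπ _).2 fun g ↦ ?_⟩
    · obtain ⟨y, hy⟩ := hp (g (π 1))
      have hyT : ∀ i : I, (i : A) • y ∈ T := by
        intro i
        have : p ((i : A) • y) = 0 := by
          have hi : π (i : A) = 0 := i.2
          rw [map_smul, hy, ← map_smul, ← map_smul, smul_eq_mul, mul_one, hi, map_zero]
        rwa [← LinearMap.mem_ker, Submodule.ker_mkQ] at this
      obtain ⟨t, ht⟩ := hET
        (LinearMap.codRestrict T (LinearMap.toSpanSingleton A X' y ∘ₗ I.subtype) hyT)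
      obtain ⟨g', hg'⟩ := toSpanSingleton_eq_lift hπ (y - t) (fun i ↦ by
        have := congrArg Subtype.val (ht i)
        rw [smul_sub, sub_eq_zero]
        exact this)
      have hyT' : y ∈ T := by
        have h5 := hST g' (π 1)
        rw [hg'] at h5
        simpa using T.add_mem h5 t.2
      have h6 : g (π 1) = 0 := by rw [← hy]; simpa [p] using hyT'
      ext x
      obtain ⟨b, rfl⟩ := hπ x
      have : π b = b • π 1 := by rw [← map_smul, smul_eq_mul, mul_one]
      rw [this, map_smul, h6]
      simp
    · obtain ⟨g', hg'⟩ := Module.projective_lifting_property p g hp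
      obtain ⟨x, hx⟩ := hEX' g'
      refine ⟨p x, fun i ↦ ?_⟩
      rw [← hg', LinearMap.comp_apply, hx, map_smul]
  have hT : IsIsoPower A S T :=
    (IsIsotypicOfType.isotypicComponent A X' (S := S)).linearEquiv_fun
  have hinj : Function.Injective (q ∘ₗ LinearMap.inl A M (Fin m → A)) := by
    rw [← LinearMap.ker_eq_bot, eq_bot_iff]
    intro x hx
    have hx : q (x, 0) = 0 := hx
    rw [← LinearMap.mem_ker, Submodule.ker_mkQ] at hx
    obtain ⟨v, hv⟩ := hx
    have hv1 : ∑ j, f j (v j) = x := by simpa [φ] using congrArg Prod.fst hv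
    have hv2 : ∀ j, v j = 0 := fun j ↦ by
      simpa [φ] using congrFun (congrArg Prod.snd hv) j
    rw [Submodule.mem_bot, ← hv1]
    exact Finset.sum_eq_zero fun j _ ↦ by rw [hv2, map_zero]
  have hker : IsIsoPower A S (LinearMap.ker (p ∘ₗ q ∘ₗ LinearMap.inl A M (Fin m → A))) := by
    refine hT.of_injective (LinearMap.codRestrict T ((q ∘ₗ LinearMap.inl A M (Fin m → A)) ∘ₗ
      Submodule.subtype _) fun x ↦ ?_) fun x y h ↦ ?_
    · have h1 := x.2
      rw [LinearMap.mem_ker, LinearMap.comp_apply, ← LinearMap.mem_ker, Submodule.ker_mkQ] at h1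
      exact h1
    · exact Subtype.ext (hinj (congrArg Subtype.val h))
  have hcoker : IsIsoPower A S
      ((X' ⧸ T) ⧸ LinearMap.range (p ∘ₗ q ∘ₗ LinearMap.inl A M (Fin m → A))) := by
    let r : (Fin m → A) →ₗ[A] _ :=
      (LinearMap.range (p ∘ₗ q ∘ₗ LinearMap.inl A M (Fin m → A))).mkQ ∘ₗ p ∘ₗ q ∘ₗ
        LinearMap.inr A M (Fin m → A)
    have hzero : ∀ x : M, (LinearMap.range (p ∘ₗ q ∘ₗ LinearMap.inl A M (Fin m → A))).mkQ
        (p (q (x, 0))) = 0 := fun x ↦ by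
      rw [← LinearMap.mem_ker, Submodule.ker_mkQ]
      exact ⟨x, rfl⟩
    have hr : Function.Surjective r := by
      intro y
      obtain ⟨y, rfl⟩ := Submodule.mkQ_surjective _ y
      obtain ⟨y, rfl⟩ := hp y
      obtain ⟨⟨x, v⟩, rfl⟩ := hq y
      refine ⟨v, ?_⟩
      have h1 : ((x, v) : M × (Fin m → A)) = (x, 0) + (0, v) := by simp
      rw [h1, map_add, map_add, map_add, hzero, zero_add]
      rfl
    -- The cokernel is generated by A^m, and I^m dies in it because it is glued to `M`; so it is a
    -- quotient of S^m.
    refine IsIsoPower.of_surjective_of_ker (LinearMap.compLeft π (Fin m)) (fun s ↦ ?_) r hr ?_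
    · choose v hv using fun j ↦ hπ (s j)
      exact ⟨v, funext hv⟩
    · intro v hv
      have hv' : ∀ j, v j ∈ I := fun j ↦ congrFun hv j
      have h1 := hφ fun j ↦ ⟨v j, hv' j⟩
      change (Submodule.mkQ _) (p (q (0, v))) = 0
      rw [← h1, hzero]
  refine ⟨X' ⧸ T, inferInstance, inferInstance, p ∘ₗ q ∘ₗ LinearMap.inl A M (Fin m → A),
    hperp, hker, hcoker, fun Z _ _ hZ F ↦ ?_⟩
  have hEZ := (subsingleton_ext_iff hπ Z).1 hZ.ext
  choose z hz using fun j ↦ hEZ (F ∘ₗ f j)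
  let G : M × (Fin m → A) →ₗ[A] Z := LinearMap.coprod F
    (∑ j, LinearMap.toSpanSingleton A Z (z j) ∘ₗ LinearMap.proj j)
  have hG : LinearMap.range φ ≤ LinearMap.ker G := by
    rintro _ ⟨v, rfl⟩
    have : ∀ j, F (f j (v j)) = (v j : A) • z j := fun j ↦ hz j (v j)
    simp [G, φ, LinearMap.prod_apply, this]
  let G' : X' →ₗ[A] Z := (LinearMap.range φ).liftQ G hG
  have hTG : T ≤ LinearMap.ker G' := by
    refine sSup_le fun N ⟨e⟩ x hx ↦ ?_
    have h1 := hZ.hom (G' ∘ₗ N.subtype ∘ₗ e.symm.toLinearMap)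
    have h2 := LinearMap.congr_fun h1 (e ⟨x, hx⟩)
    simpa using h2
  have hlift : T.liftQ G' hTG ∘ₗ p ∘ₗ q ∘ₗ LinearMap.inl A M (Fin m → A) = F := by
    refine LinearMap.ext fun b ↦ ?_
    have : G (b, 0) = F b := by simp [G]
    exact this
  refine ⟨T.liftQ G' hTG, hlift, fun g hg ↦ ?_⟩
  -- A map vanishing on `M` sends each basis vector of A^m to an element killed by `I`, that is, to
  -- the image of a map `S → Z`, which is zero.
  · have key : ∀ d : (X' ⧸ T) →ₗ[A] Z,
        d ∘ₗ p ∘ₗ q ∘ₗ LinearMap.inl A M (Fin m → A) = 0 → d = 0 := by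
      intro d hd
      have h0 : ∀ b : M, d (p (q (b, 0))) = 0 := fun b ↦ LinearMap.congr_fun hd b
      have h1 : ∀ j, d (p (q (0, Pi.single j 1))) = 0 := by
        intro j
        obtain ⟨g', hg'⟩ := toSpanSingleton_eq_lift hπ (d (p (q (0, Pi.single j 1))))
          (fun i ↦ by
            have h2 := hφ (Pi.single j i)
            rw [← map_smul, ← map_smul, ← map_smul]
            have h3 : (i : A) • ((0, Pi.single j 1) : M × (Fin m → A)) =
                (0, fun l ↦ ((Pi.single j i : Fin m → I) l : A)) := by
              ext l
              · simp
              · by_cases hl : l = j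
                · subst hl; simp
                · simp [Pi.single_eq_of_ne hl]
            rw [h3, ← h2, h0])
        rw [← hg', hZ.hom g']
        rfl
      have h2 : d ∘ₗ p ∘ₗ q = 0 := by
        apply LinearMap.prod_ext
        · ext x; simpa using h0 x
        · refine LinearMap.pi_ext' fun j ↦ ?_
          ext
          simpa using h1 j
      refine LinearMap.ext fun x ↦ ?_
      obtain ⟨x, rfl⟩ := hp x
      obtain ⟨x, rfl⟩ := hq x
      exact LinearMap.congr_fun h2 x
    have := key (g - T.liftQ G' hTG) (by
      rw [LinearMap.sub_comp, hlift, sub_eq_zero]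
      exact hg)
    exact sub_eq_zero.1 this


end Approximation

/-! ### Modules over the localization -/

section Localization

/-- A ring `B` with a structure of left `A`-module compatible with its multiplication, so that
`a ↦ a • 1` is a homomorphism of rings and the universal morphism to `S^⊥`. -/
structure IsPerpLocalization (A : Type u) [Ring A] (S : Type u) [AddCommGroup S] [Module A S]
    (B : Type u) [Ring B] [Module A B] [IsScalarTower A B B] : Prop where
  localizable : IsLocalizable A S
  isPerp : IsPerp A S B
  universal : ∀ (Z : Type u) [AddCommGroup Z] [Module A Z], IsPerp A S Z →
    ∀ z : Z, ∃! g : B →ₗ[A] Z, g 1 = z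

variable {A : Type u} [Ring A] {S : Type u} [AddCommGroup S] [Module A S]
  {B : Type u} [Ring B] [Module A B] [IsScalarTower A B B]

variable (A B) in
/-- The homomorphism of rings `a ↦ a • 1`. -/
def towerRingHom : A →+* B where
  toFun a := a • 1
  map_one' := one_smul _ _
  map_zero' := zero_smul _ _
  map_add' _ _ := add_smul _ _ _
  map_mul' a b := by rw [smul_mul_assoc, one_mul, mul_smul]

variable (A B) in
/-- The restriction of scalars of a `B`-module to `A`. -/
abbrev restrictModule (M : Type*) [AddCommGroup M] [Module B M] : Module A M :=
  Module.compHom M (towerRingHom A B)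

variable (A B) in
lemma restrictModule_isScalarTower (M : Type*) [AddCommGroup M] [Module B M] :
    let _ : Module A M := restrictModule A B M
    IsScalarTower A B M :=
  let _ : Module A M := restrictModule A B M
  ⟨fun a b m ↦ by
    change (a • b) • m = (a • (1 : B)) • b • m
    rw [← mul_smul, smul_mul_assoc, one_mul]⟩

namespace IsPerpLocalization

/-! ### Modules over the localization as the perpendicular category. -/

section Modules

variable (h : IsPerpLocalization A S B)
  {M : Type u} [AddCommGroup M] [Module B M] [Module A M] [IsScalarTower A B M] [Module.Finite B M]
  {N : Type u} [AddCommGroup N] [Module B N] [Module A N] [IsScalarTower A B N] [Module.Finite B N]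
include h

lemma isNoetherianRing [IsNoetherianRing A] : IsNoetherianRing B :=
  have := h.isPerp.finite
  isNoetherian_of_tower A inferInstance

omit [Module B M] [Module A M] [IsScalarTower A B M] [Module.Finite B M] in
-- Right exactness of Ext¹(S, -) carries its vanishing from `B^n` to the quotient `M`.
lemma ext_of_module {π : A →ₗ[A] S} (hπ : Function.Surjective π) [Module B M] [Module A M]
    [IsScalarTower A B M] [Module.Finite B M] (f : LinearMap.ker π →ₗ[A] M) :
    ∃ x : M, ∀ i : LinearMap.ker π, f i = (i : A) • x := by
  have := projective_ker h.localizable hπ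
  obtain ⟨n, p, hp⟩ := Module.Finite.exists_fin' B M
  obtain ⟨g, rfl⟩ := Module.projective_lifting_property (p.restrictScalars A) f hp
  choose x hx using fun j ↦
    (subsingleton_ext_iff hπ B).1 h.isPerp.ext (LinearMap.proj j ∘ₗ g)
  refine ⟨p x, fun i ↦ ?_⟩
  have h1 : g i = (i : A) • x := funext fun j ↦ hx j i
  change p (g i) = _
  rw [h1]
  exact map_smul (p.restrictScalars A) _ _

/-- Finitely generated modules over the localization are perpendicular to `S`. -/
theorem isPerp_of_module [IsNoetherianRing A] : IsPerp A S M := by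
  have := h.localizable.simple
  have := IsSimpleModule.nontrivial A S
  have := h.isNoetherianRing
  have := h.isPerp.finite
  obtain ⟨s, hs⟩ := exists_ne (0 : S)
  let π : A →ₗ[A] S := LinearMap.toSpanSingleton A S s
  have hπ : Function.Surjective π := IsSimpleModule.toSpanSingleton_surjective A hs
  refine ⟨Module.Finite.trans B M, fun f ↦ ?_,
    (subsingleton_ext_iff hπ M).2 fun f ↦ h.ext_of_module hπ f⟩
  obtain ⟨n, p, hp⟩ := Module.Finite.exists_fin' B M
  obtain ⟨y, hy⟩ := hp (f (π 1))
  -- Ext¹(S, ker p) = 0 corrects the lift `y` by some `t` in `ker p` so that `y - t` defines a map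
  -- `S → B^n`. That map is zero, so `y` lies in `ker p`.
  have hK : ∀ i : LinearMap.ker π, (i : A) • y ∈ LinearMap.ker p := fun i ↦ by
    have h1 : π (i : A) = 0 := i.2
    have h2 : p ((i : A) • y) = (i : A) • p y := map_smul (p.restrictScalars A) _ _
    rw [LinearMap.mem_ker, h2, hy, ← map_smul, ← map_smul, smul_eq_mul, mul_one, h1, map_zero]
  let g : LinearMap.ker π →ₗ[A] LinearMap.ker p :=
    { toFun := fun i ↦ ⟨(i : A) • y, hK i⟩
      map_add' := fun i j ↦ Subtype.ext (add_smul _ _ _)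
      map_smul' := fun a i ↦ Subtype.ext (mul_smul _ _ _) }
  obtain ⟨t, ht⟩ := h.ext_of_module hπ g
  obtain ⟨q, hq⟩ := toSpanSingleton_eq_lift hπ (y - t) (fun i ↦ by
    rw [smul_sub, sub_eq_zero]
    exact congrArg Subtype.val (ht i))
  have hq0 : q = 0 := LinearMap.ext fun s ↦ funext fun j ↦
    LinearMap.congr_fun (h.isPerp.hom (LinearMap.proj j ∘ₗ q)) s
  have hyt : y = t := by
    rw [← sub_eq_zero, ← hq, hq0, LinearMap.zero_apply]
  have h6 : f (π 1) = 0 := by rw [← hy, hyt]; exact t.2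
  ext x
  obtain ⟨b, rfl⟩ := hπ x
  have : π b = b • π 1 := by rw [← map_smul, smul_eq_mul, mul_one]
  rw [this, map_smul, h6, smul_zero, LinearMap.zero_apply]

omit [Module.Finite B M] in
/-- Restriction of scalars along the localization is full. -/
lemma map_smul [IsNoetherianRing A] (f : M →ₗ[A] N) (b : B) (m : M) : f (b • m) = b • f m := by
  -- Both sides are `A`-linear in `b` and agree at `b = 1`.
  have h1 := (h.universal N h.isPerp_of_module (f m)).unique
    (y₁ := f ∘ₗ (LinearMap.toSpanSingleton B M m).restrictScalars A)
    (y₂ := (LinearMap.toSpanSingleton B N (f m)).restrictScalars A) (by simp) (by simp)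
  exact LinearMap.congr_fun h1 b

/-- A morphism of `A`-modules between modules over the localization, as a morphism of modules over
the localization. -/
def extendScalars [IsNoetherianRing A] (f : M →ₗ[A] N) : M →ₗ[B] N where
  __ := f
  map_smul' := h.map_smul f

omit [Module B M] [IsScalarTower A B M] [Module.Finite B M] in
/-- A module perpendicular to `S` is a module over the localization. -/
lemma exists_module (hM : IsPerp A S M) :
    ∃ _ : Module B M, IsScalarTower A B M ∧ Module.Finite B M := by
  choose e he using fun m ↦ (h.universal M hM m).exists
  have hext : ∀ f g : B →ₗ[A] M, f 1 = g 1 → f = g := fun f g hfg ↦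
    (h.universal M hM (g 1)).unique hfg rfl
  let _ : Module B M :=
    { smul := fun b m ↦ e m b
      one_smul := he
      mul_smul := fun b c m ↦ by
        let r : B →ₗ[A] B := (LinearMap.toSpanSingleton B B c).restrictScalars A
        have h1 : e m ∘ₗ r = e (e m c) := hext _ _ (by simp [r, he])
        exact LinearMap.congr_fun h1 b
      smul_zero := fun b ↦ by
        have h1 : e 0 = 0 := hext _ _ (by simp [he])
        exact LinearMap.congr_fun h1 b
      smul_add := fun b x y ↦ by
        have h1 : e (x + y) = e x + e y := hext _ _ (by simp [he])
        exact LinearMap.congr_fun h1 b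
      add_smul := fun b c m ↦ map_add (e m) b c
      zero_smul := fun m ↦ map_zero (e m) }
  have : IsScalarTower A B M := ⟨fun a b m ↦ LinearMap.map_smul (e m) a b⟩
  have := hM.finite
  exact ⟨inferInstance, inferInstance, Module.Finite.of_restrictScalars_finite A B M⟩

end Modules

/-! ### Comparing homological dimensions over `A` and over the localization. -/

section Dimensions

variable (k : Type v) [CommRing k] [IsArtinianRing k] [Algebra k A] [Module.Finite k A]
variable (h : IsPerpLocalization A S B)
include k h

/-- Compare `B` with the constructed approximation `Y` of `A`. It is enough that `B` is a retract of
`Y` under `A`, since powers of `S` are closed under submodules and quotients. -/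
lemma isIsoPower : IsIsoPower A S (LinearMap.ker (LinearMap.toSpanSingleton A B 1)) ∧
    IsIsoPower A S (B ⧸ LinearMap.range (LinearMap.toSpanSingleton A B 1)) := by
  have := h.localizable.simple
  obtain ⟨Y, _, _, l, hY, hker, hcoker, huniv⟩ := exists_perp_approximation k h.localizable A
  obtain ⟨g, hg, -⟩ := huniv B h.isPerp (LinearMap.toSpanSingleton A B 1)
  obtain ⟨g', hg', -⟩ := h.universal Y hY (l 1)
  have hg1 : ∀ a, g (l a) = a • (1 : B) := fun a ↦ LinearMap.congr_fun hg a
  have hg1' : ∀ a : A, g' (a • 1) = l a := fun a ↦ by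
    rw [LinearMap.map_smul, hg', ← LinearMap.map_smul, smul_eq_mul, mul_one]
  have h2 : g ∘ₗ g' = LinearMap.id := (h.universal B h.isPerp 1).unique
    (by rw [LinearMap.comp_apply, hg', hg1, one_smul]) rfl
  refine ⟨hker.of_injective (Submodule.inclusion fun a ha ↦ ?_) (Submodule.inclusion_injective _),
    hcoker.of_surjective (Submodule.mapQ _ _ g ?_) ?_⟩
  · have ha : a • (1 : B) = 0 := ha
    rw [LinearMap.mem_ker, ← hg1', ha, map_zero]
  · rintro _ ⟨a, rfl⟩
    exact ⟨a, (hg1 a).symm⟩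
  · intro y
    obtain ⟨y, rfl⟩ := Submodule.mkQ_surjective _ y
    exact ⟨Submodule.mkQ _ (g' y), congrArg (Submodule.mkQ _) (LinearMap.congr_fun h2 y)⟩

lemma finProjDim_self : FinProjDim A B := by
  have hS : FinProjDim A S := ⟨1, h.localizable.projDim⟩
  exact .codomain (f := LinearMap.toSpanSingleton A B 1) ((h.isIsoPower k).1.finProjDim hS)
    ((h.isIsoPower k).2.finProjDim hS) finProjDim_of_projective

variable {M : Type u} [AddCommGroup M] [Module B M] [Module A M] [IsScalarTower A B M]
  [Module.Finite B M]

/-- The inclusion of S^⊥ has an exact left adjoint. By Baer's criterion only a left ideal `I` of `A`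
matters: its approximation `Y` still embeds in `B`, so the map extends over `B` and restricts to
`A`. -/
lemma injective_of_injective [Module.Injective B M] : Module.Injective A M := by
  have := h.localizable.simple
  have : IsNoetherianRing A := isNoetherian_of_tower k inferInstance
  have := h.isNoetherianRing
  refine Module.Baer.injective fun I g ↦ ?_
  obtain ⟨Y, _, _, l, hY, -, hcoker, huniv⟩ := exists_perp_approximation k h.localizable I
  obtain ⟨_, _, _⟩ := h.exists_module hY
  let η : A →ₗ[A] B := LinearMap.toSpanSingleton A B 1
  obtain ⟨r, hr, -⟩ := huniv B h.isPerp (η ∘ₗ I.subtype)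
  obtain ⟨g₁, hg₁, -⟩ := huniv M h.isPerp_of_module g
  let K := LinearMap.ker (h.extendScalars r)
  have hK : IsPerp A S K := h.isPerp_of_module
  -- the kernel of `r` meets the image of `I` trivially
  have hzero : ∀ i : I, r (l i) = 0 → l i = 0 := by
    intro i hi
    have hJ : IsIsoPower A S (LinearMap.ker (η ∘ₗ I.subtype)) :=
      (h.isIsoPower k).1.of_injective (LinearMap.codRestrict _ (I.subtype ∘ₗ Submodule.subtype _)
        fun x ↦ x.2) fun x y hxy ↦ Subtype.ext (Subtype.ext
          (congrArg (fun z : LinearMap.ker (LinearMap.toSpanSingleton A B 1) ↦ (z : A)) hxy))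
    let φ : LinearMap.ker (η ∘ₗ I.subtype) →ₗ[A] K :=
      { toFun := fun x ↦ ⟨l x, (LinearMap.congr_fun hr (x : I)).trans x.2⟩
        map_add' := fun x y ↦ Subtype.ext (map_add l _ _)
        map_smul' := fun a x ↦ Subtype.ext (LinearMap.map_smul l _ _) }
    have h1 := LinearMap.congr_fun (hJ.eq_zero hK.hom φ)
      ⟨i, (LinearMap.congr_fun hr i).symm.trans hi⟩
    exact congrArg Subtype.val h1
  -- The kernel `K` of `Y → B` embeds in the cokernel of `l`, so it is a power of `S`; lying in S^⊥
  -- as well, it is zero.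
  let ψ : K →ₗ[A] Y ⧸ LinearMap.range l := (LinearMap.range l).mkQ ∘ₗ
    ((LinearMap.ker (h.extendScalars r)).subtype.restrictScalars A)
  have hψ : Function.Injective ψ := by
    rw [← LinearMap.ker_eq_bot, eq_bot_iff]
    intro x hx
    have hx : (x : Y) ∈ LinearMap.range l := by
      rw [← Submodule.ker_mkQ (LinearMap.range l)]; exact hx
    obtain ⟨i, hi⟩ := hx
    refine Subtype.ext (hi.symm.trans (hzero i ?_))
    rw [hi]
    exact x.2
  have hK0 : (LinearMap.id : K →ₗ[A] K) = 0 := (hcoker.of_injective ψ hψ).eq_zero hK.hom _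
  have hinj : Function.Injective (h.extendScalars r) := by
    rw [← LinearMap.ker_eq_bot, eq_bot_iff]
    intro x hx
    exact congrArg Subtype.val (LinearMap.congr_fun hK0 ⟨x, hx⟩)
  obtain ⟨F, hF⟩ := Module.Injective.extension_property B M Y B (h.extendScalars r) hinj
    (h.extendScalars g₁)
  refine ⟨F.restrictScalars A ∘ₗ η, fun x hx ↦ ?_⟩
  have h1 : r (l ⟨x, hx⟩) = η x := LinearMap.congr_fun hr ⟨x, hx⟩
  have h2 : g₁ (l ⟨x, hx⟩) = g ⟨x, hx⟩ := LinearMap.congr_fun hg₁ ⟨x, hx⟩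
  rw [← h2, LinearMap.comp_apply, ← h1]
  exact LinearMap.congr_fun hF _

lemma injective_iff : Module.Injective B M ↔ Module.Injective A M := by
  refine ⟨fun _ ↦ h.injective_of_injective k, fun _ ↦ Module.Baer.injective fun I g ↦ ?_⟩
  have : IsNoetherianRing A := isNoetherian_of_tower k inferInstance
  obtain ⟨F, hF⟩ := Module.Injective.extension_property A M I B (I.subtype.restrictScalars A)
    I.injective_subtype (g.restrictScalars A)
  exact ⟨h.extendScalars F, fun x hx ↦ LinearMap.congr_fun hF ⟨x, hx⟩⟩

variable {Q : Type u} [AddCommGroup Q] [Module B Q] [Module.Finite B Q]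
  [Module.Injective B Q] (hQ : ∀ (X : Type u) [AddCommGroup X] [Module B X] [Module.Finite B X],
    ∃ (n : ℕ) (f : X →ₗ[B] Fin n → Q), Function.Injective f)
include hQ

omit [IsScalarTower A B M] [Module A M] in
-- One embedding serves over both rings, so dimension shifts over `B` and over `A` run in parallel.
lemma exists_injective_copresentation :
    ∃ (W C : Type u) (_ : AddCommGroup W) (_ : AddCommGroup C) (_ : Module B W) (_ : Module B C)
      (_ : Module A W) (_ : Module A C) (i : M →ₗ[B] W) (p : W →ₗ[B] C),
      IsScalarTower A B W ∧ IsScalarTower A B C ∧ Module.Finite B W ∧ Module.Finite B C ∧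
      Module.Injective B W ∧ Module.Injective A W ∧
      Function.Injective i ∧ Function.Exact i p ∧ Function.Surjective p := by
  let _ : Module A Q := restrictModule A B Q
  have : IsScalarTower A B Q := restrictModule_isScalarTower A B Q
  obtain ⟨n, i, hi⟩ := hQ M
  exact ⟨Fin n → Q, (Fin n → Q) ⧸ LinearMap.range i, inferInstance, inferInstance, inferInstance,
    inferInstance, inferInstance, inferInstance, i, (LinearMap.range i).mkQ, inferInstance,
    inferInstance, inferInstance, inferInstance, inferInstance, h.injective_of_injective k, hi,
    i.exact_map_mkQ_range, Submodule.mkQ_surjective _⟩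

theorem finInjDim_iff : FinInjDim B M ↔ FinInjDim A M := by
  refine exists_congr fun d ↦ ?_
  induction d generalizing M with
  | zero =>
    rw [← injective_iff_hasInjectiveDimensionLE_zero, ← injective_iff_hasInjectiveDimensionLE_zero,
      h.injective_iff k]
  | succ d ih =>
    obtain ⟨W, C, _, _, _, _, _, _, i, p, _, _, _, _, _, _, hi, hip, hp⟩ :=
      h.exists_injective_copresentation k hQ (M := M)
    exact (hasInjectiveDimensionLE_succ_iff hi hip hp d).trans (ih.trans
      (hasInjectiveDimensionLE_succ_iff (f := i.restrictScalars A) (g := p.restrictScalars A)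
        hi hip hp d).symm)

omit hQ in
-- Free `B`-modules need not be projective over `A`, only of finite projective dimension, so the
-- bound may grow.
lemma finProjDim_restrict (hM : FinProjDim B M) : FinProjDim A M := by
  have : IsNoetherianRing A := isNoetherian_of_tower k inferInstance
  have := h.isNoetherianRing
  obtain ⟨d, hd⟩ := hM
  induction d generalizing M with
  | zero =>
    have := projective_iff_hasProjectiveDimensionLE_zero.2 hd
    obtain ⟨n, p, i, -, -, hpi⟩ := Module.Finite.exists_comp_eq_id_of_projective B M
    exact .of_retract (i.restrictScalars A) (p.restrictScalars A)
      (LinearMap.ext fun x ↦ LinearMap.congr_fun hpi x) ((h.finProjDim_self k).pi n)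
  | succ d ih =>
    obtain ⟨n, p, hp⟩ := Module.Finite.exists_fin' B M
    have hK := (hasProjectiveDimensionLE_succ_iff (LinearMap.ker p).injective_subtype
      p.exact_subtype_ker_map hp d).1 hd
    exact .right (f := (LinearMap.ker p).subtype.restrictScalars A) (g := p.restrictScalars A)
      (LinearMap.ker p).injective_subtype p.exact_subtype_ker_map hp (ih hK)
      ((h.finProjDim_self k).pi n)

omit [Module.Finite B M] in
-- Shift along common injectives down to degree one. There vanishing is a lifting property, and an
-- `A`-linear lift is automatically `B`-linear.
lemma subsingleton_ext {N : Type u} [AddCommGroup N] [Module B N] [Module A N]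
    [IsScalarTower A B N] [Module.Finite B N] (i : ℕ)
    (hMN : Subsingleton (Ext.{u} (ModuleCat.of A M) (ModuleCat.of A N) (i + 1))) :
    Subsingleton (Ext.{u} (ModuleCat.of B M) (ModuleCat.of B N) (i + 1)) := by
  have : IsNoetherianRing A := isNoetherian_of_tower k inferInstance
  induction i generalizing N with
  | zero =>
    obtain ⟨W, C, _, _, _, _, _, _, j, p, _, _, _, _, _, _, hj, hjp, hp⟩ :=
      h.exists_injective_copresentation k hQ (M := N)
    refine (subsingleton_ext_one_iff_lift hj hjp hp M).2 fun φ ↦ ?_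
    obtain ⟨ψ, hψ⟩ := (subsingleton_ext_one_iff_lift (f := j.restrictScalars A)
      (g := p.restrictScalars A) hj hjp hp M).1 hMN (φ.restrictScalars A)
    exact ⟨h.extendScalars ψ, LinearMap.ext fun x ↦ LinearMap.congr_fun hψ x⟩
  | succ i ih =>
    obtain ⟨W, C, _, _, _, _, _, _, j, p, _, _, _, _, _, _, hj, hjp, hp⟩ :=
      h.exists_injective_copresentation k hQ (M := N)
    exact (subsingleton_ext_succ_iff hj hjp hp M i).2
      (ih ((subsingleton_ext_succ_iff (f := j.restrictScalars A) (g := p.restrictScalars A)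
        hj hjp hp M i).1 hMN))

theorem finProjDim_iff : FinProjDim B M ↔ FinProjDim A M := by
  refine ⟨h.finProjDim_restrict k, fun ⟨d, hd⟩ ↦ ⟨d, ?_⟩⟩
  have : IsNoetherianRing A := isNoetherian_of_tower k inferInstance
  have := h.isNoetherianRing
  refine hasProjectiveDimensionLE_of_ext d fun N _ _ _ ↦ ?_
  let _ : Module A N := restrictModule A B N
  have : IsScalarTower A B N := restrictModule_isScalarTower A B N
  exact h.subsingleton_ext k hQ d (HasProjectiveDimensionLT.subsingleton _ (d + 1) (d + 1) le_rfl _)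

end Dimensions

end IsPerpLocalization

end Localization

/-! ### Gorenstein algebras and localization -/

/-! ### Asymmetry of extensions between localizable modules. -/

section Swap

variable {A : Type u} [Ring A] {S S' : Type u} [AddCommGroup S] [Module A S]
  [AddCommGroup S'] [Module A S']

lemma subsingleton_ext_one_of_hom_ker {P X : Type u} [AddCommGroup P] [Module A P]
    [Module.Projective A P] [AddCommGroup X] [Module A X] {p : P →ₗ[A] S}
    (hp : Function.Surjective p) (h : ∀ f : LinearMap.ker p →ₗ[A] X, f = 0) :
    Subsingleton (Ext.{u} (ModuleCat.of A S) (ModuleCat.of A X) 1) := by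
  have hx := LinearMap.shortExact_shortComplexKer hp
  have h2 : Projective p.shortComplexKer.X₂ := (IsProjective.iff_projective P).1 inferInstance
  refine subsingleton_of_forall_eq 0 fun e ↦ ?_
  obtain ⟨f, rfl⟩ := precomp_extClass_surjective_of_projective_X₂ (ModuleCat.of A X) hx 0 e
  obtain ⟨f, rfl⟩ := (Ext.mk₀_bijective _ _).2 f
  have hf : f = 0 := ModuleCat.hom_ext (h f.hom)
  rw [hf, Ext.mk₀_zero, map_zero]

lemma IsLocalizable.exists_lt_length [IsArtinianRing A] (hS : IsLocalizable A S)
    {P : Type u} [AddCommGroup P] [Module A P] [Module.Finite A P] [Module.Projective A P]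
    {f : P →ₗ[A] S} (hf : f ≠ 0) :
    Function.Surjective f ∧ Module.Finite A (LinearMap.ker f) ∧
      Module.Projective A (LinearMap.ker f) ∧
      Module.length A (LinearMap.ker f) < Module.length A P := by
  have := hS.simple
  have hf' := LinearMap.surjective_of_ne_zero hf
  refine ⟨hf', inferInstance, ?_, Submodule.length_lt fun h ↦ hf (LinearMap.ker_eq_top.1 h)⟩
  rw [projective_iff_hasProjectiveDimensionLE_zero]
  exact (hasProjectiveDimensionLE_succ_iff (LinearMap.ker f).injective_subtype
    f.exact_subtype_ker_map hf' 0).1 hS.projDim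

/-- Of two localizable modules, one has no nontrivial extensions by the other. -/
theorem IsLocalizable.ext_or_ext [IsArtinianRing A] (hS : IsLocalizable A S)
    (hS' : IsLocalizable A S') :
    Subsingleton (Ext.{u} (ModuleCat.of A S) (ModuleCat.of A S') 1) ∨
      Subsingleton (Ext.{u} (ModuleCat.of A S') (ModuleCat.of A S) 1) := by
  have := hS.simple
  by_contra! hne
  -- If both Ext groups were nonzero, no finitely generated projective would map onto either simple.
  -- A nonzero map from `P` has a shorter projective kernel, which by induction has no map to the
  -- other simple, forcing an Ext group to vanish. Taking `P = A` is absurd.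
  have key : ∀ (n : ℕ) (P : Type u) [AddCommGroup P] [Module A P] [Module.Finite A P]
      [Module.Projective A P], Module.length A P = n →
      (∀ f : P →ₗ[A] S, f = 0) ∧ ∀ f : P →ₗ[A] S', f = 0 := by
    intro n
    induction n using Nat.strong_induction_on with
    | _ n ih =>
      intro P _ _ _ _ hP
      constructor
      · intro f
        by_contra hf
        obtain ⟨hf', _, _, hlt⟩ := hS.exists_lt_length hf
        obtain ⟨m, hm⟩ := ENat.ne_top_iff_exists.1 hlt.ne_top
        rw [← hm, hP, Nat.cast_lt] at hlt
        exact not_subsingleton_iff_nontrivial.2 hne.1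
          (subsingleton_ext_one_of_hom_ker hf' (ih m hlt _ hm.symm).2)
      · intro f
        by_contra hf
        obtain ⟨hf', _, _, hlt⟩ := hS'.exists_lt_length hf
        obtain ⟨m, hm⟩ := ENat.ne_top_iff_exists.1 hlt.ne_top
        rw [← hm, hP, Nat.cast_lt] at hlt
        exact not_subsingleton_iff_nontrivial.2 hne.2
          (subsingleton_ext_one_of_hom_ker hf' (ih m hlt _ hm.symm).1)
  obtain ⟨m, hm⟩ := ENat.ne_top_iff_exists.1 (Module.length_ne_top (R := A) (M := A))
  have := IsSimpleModule.nontrivial A S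
  obtain ⟨s, hs⟩ := exists_ne (0 : S)
  have h1 := LinearMap.congr_fun ((key m A hm.symm).1 (LinearMap.toSpanSingleton A S s)) 1
  exact hs (by simpa using h1)

end Swap

/-! ### Transfer of the Gorenstein property in both directions. -/

section Gorenstein

variable (k : Type v) [CommRing k] [IsArtinianRing k] {A : Type u} [Ring A] [Algebra k A]
  [Module.Finite k A] {S : Type u} [AddCommGroup S] [Module A S]
  {B : Type u} [Ring B] [Module A B] [IsScalarTower A B B] [Algebra k B] [Module.Finite k B]

include k

/-- The localization of a Gorenstein algebra is Gorenstein. -/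
theorem IsPerpLocalization.isGorenstein (h : IsPerpLocalization A S B) (hA : IsGorenstein A) :
    IsGorenstein B := by
  have := h.localizable.simple
  have : IsNoetherianRing A := isNoetherian_of_tower k inferInstance
  have := h.isPerp.finite
  obtain ⟨QA, _, _, _, _, hQA, hA'⟩ := exists_injective_cogenerator k A
  obtain ⟨Q, _, _, _, _, hQ, hB'⟩ := exists_injective_cogenerator k B
  have hl : FinInjDim A A := hA.1
  have hr : FinProjDim A QA := hA'.1 hA.2
  have hS : FinInjDim A S := FinProjDim.finInjDim hl ⟨1, h.localizable.projDim⟩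
  refine ⟨(h.finInjDim_iff k hQ).2 (.codomain (f := LinearMap.toSpanSingleton A B 1)
    ((h.isIsoPower k).1.finInjDim hS) ((h.isIsoPower k).2.finInjDim hS) hl), hB'.2 ?_⟩
  let _ : Module A Q := restrictModule A B Q
  have : IsScalarTower A B Q := restrictModule_isScalarTower A B Q
  have : Module.Injective A Q := h.injective_of_injective k
  have : Module.Finite A Q := Module.Finite.trans B Q
  -- `Q` is injective over `A`, so the right-hand condition on `A` bounds its projective dimension
  -- over `A`, hence over `B`.
  exact (h.finProjDim_iff k hQ).2 (FinInjDim.finProjDim hQA hr finInjDim_of_injective)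

variable {S' : Type u} [AddCommGroup S'] [Module A S']
  {B' : Type u} [Ring B'] [Module A B'] [IsScalarTower A B' B'] [Algebra k B'] [Module.Finite k B']

/-- An algebra is Gorenstein if its localizations at two localizable modules are, the second of
which is perpendicular to the first. -/
theorem IsPerpLocalization.isGorenstein_of_isPerp (h : IsPerpLocalization A S B)
    (h' : IsPerpLocalization A S' B') (hSS' : IsPerp A S S') (hB : IsGorenstein B)
    (hB' : IsGorenstein B') : IsGorenstein A := by
  have := h.localizable.simple
  have := h'.localizable.simple
  have : IsNoetherianRing A := isNoetherian_of_tower k inferInstance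
  have := h.isNoetherianRing
  have := h'.isNoetherianRing
  obtain ⟨QA, _, _, _, _, hQA, hA'⟩ := exists_injective_cogenerator k A
  obtain ⟨Q, _, _, _, _, hQ, hQB⟩ := exists_injective_cogenerator k B
  obtain ⟨Q', _, _, _, _, hQ', -⟩ := exists_injective_cogenerator k B'
  have pS : FinProjDim A S := ⟨1, h.localizable.projDim⟩
  have pS' : FinProjDim A S' := ⟨1, h'.localizable.projDim⟩
  have iS' : FinInjDim A S' := by
    obtain ⟨_, _, _⟩ := h.exists_module hSS'
    exact (h.finInjDim_iff k hQ).1 (FinProjDim.finInjDim hB.1 ((h.finProjDim_iff k hQ).2 pS'))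
  -- `S` need not lie in S'^⊥, but its approximation there differs from it by powers of `S'`, whose
  -- injective dimension is already finite.
  have iS : FinInjDim A S := by
    obtain ⟨Y, _, _, l, hY, hker, hcoker, -⟩ := exists_perp_approximation k h'.localizable S
    have pY : FinProjDim A Y := .codomain (hker.finProjDim pS') (hcoker.finProjDim pS') pS
    obtain ⟨_, _, _⟩ := h'.exists_module hY
    exact .domain (hker.finInjDim iS') (hcoker.finInjDim iS') ((h'.finInjDim_iff k hQ').1
      (FinProjDim.finInjDim hB'.1 ((h'.finProjDim_iff k hQ').2 pY)))
  have := h.isPerp.finite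
  refine ⟨FinInjDim.domain (f := LinearMap.toSpanSingleton A B 1) ((h.isIsoPower k).1.finInjDim iS)
    ((h.isIsoPower k).2.finInjDim iS) ((h.finInjDim_iff k hQ).1 hB.1), hA'.2 ?_⟩
  -- Finite injective dimension passes from `QA` to `Y`. Over `B` it becomes finite projective
  -- dimension, which returns to `QA` because `S` has finite projective dimension.
  obtain ⟨Y, _, _, l, hY, hker, hcoker, -⟩ := exists_perp_approximation k h.localizable QA
  have iY : FinInjDim A Y :=
    .codomain (hker.finInjDim iS) (hcoker.finInjDim iS) finInjDim_of_injective
  obtain ⟨_, _, _⟩ := h.exists_module hY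
  exact .domain (hker.finProjDim pS) (hcoker.finProjDim pS) ((h.finProjDim_iff k hQ).1
    (FinInjDim.finProjDim hQ (hQB.1 hB.2) ((h.finInjDim_iff k hQ).2 iY)))

end Gorenstein

section LeftRetraction

variable (k : Type v) [CommRing k] [IsArtinianRing k] (A : Type u) [Ring A] [Algebra k A]
  [Module.Finite k A] (S : Type u) [AddCommGroup S] [Module A S] (hS : IsLocalizable A S)

instance : IsScalarTower A (LeftRetraction k A S hS) (LeftRetraction k A S hS) :=
  ⟨fun a x y ↦ LinearMap.map_smul (LeftRetraction.extend y) a x⟩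

lemma LeftRetraction.isPerpLocalization :
    IsPerpLocalization A S (LeftRetraction k A S hS) := by
  refine ⟨hS, LeftRetraction.isPerp k A S hS, fun Z _ _ hZ z ↦ ?_⟩
  obtain ⟨g, hg, huniq⟩ :=
    LeftRetraction.universal k A S hS Z hZ (LinearMap.toSpanSingleton A Z z)
  refine ⟨g, (LinearMap.congr_fun hg 1).trans (one_smul A z), fun g' hg' ↦ huniq g' ?_⟩
  exact LinearMap.ext_ring ((show _ = z from hg').trans (one_smul A z).symm)

end LeftRetraction

lemma isPerp_of_ext {A : Type u} [Ring A] {S S' : Type u} [AddCommGroup S] [Module A S]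
    [AddCommGroup S'] [Module A S'] [IsSimpleModule A S] [IsSimpleModule A S']
    (hne : ¬ Nonempty (S ≃ₗ[A] S'))
    (h : Subsingleton (Ext.{u} (ModuleCat.of A S) (ModuleCat.of A S') 1)) : IsPerp A S S' :=
  ⟨inferInstance, fun f ↦ by
    by_contra hf
    exact hne ⟨LinearEquiv.ofBijective f (LinearMap.bijective_of_ne_zero hf)⟩, h⟩

end Retraction

theorem mainTheorem8 (k : Type v) [CommRing k] [IsArtinianRing k]
    (A : Type u) [Ring A] [Algebra k A] [Module.Finite k A]
    (S : Type u) [AddCommGroup S] [Module A S] (hS : Retraction.IsLocalizable A S)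
    (S' : Type u) [AddCommGroup S'] [Module A S'] (hS' : Retraction.IsLocalizable A S')
    (hne : ¬ Nonempty (S ≃ₗ[A] S')) :
    Retraction.IsGorenstein A ↔
      Retraction.IsGorenstein (Retraction.LeftRetraction k A S hS) ∧
        Retraction.IsGorenstein (Retraction.LeftRetraction k A S' hS') := by
  have := hS.simple
  have := hS'.simple
  have h := Retraction.LeftRetraction.isPerpLocalization k A S hS
  have h' := Retraction.LeftRetraction.isPerpLocalization k A S' hS'
  refine ⟨fun hA ↦ ⟨h.isGorenstein k hA, h'.isGorenstein k hA⟩, fun ⟨hB, hB'⟩ ↦ ?_⟩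
  have : IsArtinianRing A := isArtinian_of_tower k inferInstance
  -- The vanishing Ext group decides which simple is perpendicular to the other; the two cases are
  -- symmetric.
  rcases hS.ext_or_ext hS' with hext | hext
  · exact h.isGorenstein_of_isPerp k h' (Retraction.isPerp_of_ext hne hext) hB hB'
  · exact h'.isGorenstein_of_isPerp k h
      (Retraction.isPerp_of_ext (fun ⟨e⟩ ↦ hne ⟨e.symm⟩) hext) hB' hB
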